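/- Let $a_i=\frac1{\sqrt2}(x_i+\partial_{x_i})$ and $a_i^*=\frac1{\sqrt2}(x_i-\partial_{x_i})$, $i=1,2$, with derivatives in the sense of distributions, and let $D(H_0)=D(-\Delta)\cap D(x_1^2+x_2^2)=\{u\in L^2(\mathbb R^2):\Delta u\in L^2,\ (x_1^2+x_2^2)u\in L^2\}$ be the domain of the two-dimensional harmonic oscillator $H_0=\frac12(-\Delta+x_1^2+x_2^2)=a_1^*a_1+a_2^*a_2+1$. Let $g$ be real with $|g|<2$. Then $(a_1^*a_1+a_2^*a_2+ig\,a_2^*a_1+1)u\in L^2$ for all $u\in D(H_0)$, and the operator $$H(g)=a_1^*a_1+a_2^*a_2+ig\,a_2^*a_1+1,\qquad D(H(g))=D(H_0),$$ in $L^2(\mathbb R^2)$ has the following properties. 1. $H(g)$ has discrete spectrum: every point of the spectrum is isolated in it and has finite algebraic multiplicity (rank of the Riesz projection). 2. The spectrum of $H(g)$, and likewise the set of its eigenvalues, is $\{\lambda_m=m+1: m=0,1,2,\dots\}$. Each $\lambda_m$ has algebraic multiplicity $m+1$ (both as the rank of the Riesz projection and as the dimension of the space of generalized eigenvectors) and,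 if $g\neq0$, geometric multiplicity $1$. 3. Let $\psi_k$ be the $k$-th normalized Hermite function on $\mathbb R$ (so $\psi_k(x)=(\sqrt\pi\,2^kk!)^{-1/2}H_k(x)e^{-x^2/2}$ with the Hermite polynomial $H_k$), let $\varphi_{m,h}(x_1,x_2)=\psi_h(x_1)\psi_{m-h}(x_2)$ for $0\le h\le m$, and let $\mathcal H_m$ be the span of $\varphi_{m,0},\dots,\varphi_{m,m}$. Then $(\varphi_{m,h})_{0\le h\le m}$ is an orthonormal basis of $\mathcal H_m$, so $\dim\mathcal H_m=m+1$; $L^2(\mathbb R^2)=\bigoplus_{m\ge0}\mathcal H_m$ is an orthogonal Hilbert sum; $\mathcal H_m\subset D(H(g))$ and $H(g)\mathcal H_m\subset\mathcal H_m$. With $\tilde H_m=H(g)|_{\mathcal H_m}$ one has $H(g)=\bigoplus_{m\ge0}\tilde H_m$, that is, with $P_m$ the orthogonal projection onto $\mathcal H_m$, $D(H(g))=\{u\in L^2:\sum_m\|\tilde H_mP_mu\|^2<\infty\}$ and $H(g)u=\sum_m\tilde H_mP_mu$ for such $u$. In the basis $(\varphi_{m,0},\dots,\varphi_{m,m})$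 the operator $\tilde H_m$ is represented by the $(m+1)\times(m+1)$ matrix $$(m+1)I+ig\,D_m,$$ where the only nonzero entries of $D_m$ are those on the first superdiagonal, which are $\sqrt{m},\sqrt{2(m-1)},\sqrt{3(m-2)},\dots,\sqrt{m}$ (that is, $\sqrt{h(m-h+1)}$ for $h=1,\dots,m$). The matrix $D_m$ is nilpotent of order exactly $m+1$: $D_m^{m+1}=0$ and $D_m^m\neq0$. 4. If $g\ne0$, then $\tilde H_m$ is not diagonalizable for any $m\ge1$, and $H(g)$ is not diagonalizable: its eigenvectors do not even span a dense subspace of $L^2(\mathbb R^2)$. -/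

import Mathlib

open MeasureTheory
open scoped SchwartzMap LineDeriv Laplacian ENNReal InnerProductSpace

noncomputable section

namespace PTOscillator

/-! ### Spectral theory of (possibly unbounded) operators -/

section Spectral

variable {E : Type*} [NormedAddCommGroup E] [NormedSpace ℂ E]

/-- `R` is a bounded two-sided inverse of `T - z : D(T) → E`. -/
def IsResolventAt (T : E →ₗ.[ℂ] E) (z : ℂ) (R : E →L[ℂ] E) : Prop :=
  (∀ v : E, ∃ h : R v ∈ T.domain, T ⟨R v, h⟩ - z • R v = v) ∧
    ∀ u : T.domain, R (T u - z • (u : E)) = u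

/-- The resolvent set of `T`. -/
def resolventSet (T : E →ₗ.[ℂ] E) : Set ℂ := {z | ∃ R : E →L[ℂ] E, IsResolventAt T z R}

/-- The spectrum of `T`. -/
def spec (T : E →ₗ.[ℂ] E) : Set ℂ := (resolventSet T)ᶜ

open Classical in
/-- The resolvent `(T - z)⁻¹` (zero, by convention, if `z` is in the spectrum). -/
def resolvent (T : E →ₗ.[ℂ] E) (z : ℂ) : E →L[ℂ] E :=
  if h : ∃ R : E →L[ℂ] E, IsResolventAt T z R then h.choose else 0

/-- The eigenspace `{u ∈ D(T) | T u = μ u}` (zero if `μ` is not an eigenvalue). -/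
def eigenspace (T : E →ₗ.[ℂ] E) (μ : ℂ) : Submodule ℂ E :=
  T.graph.comap (LinearMap.id.prod (μ • LinearMap.id))

/-- `μ` is an eigenvalue of `T`: there is a nonzero `u ∈ D(T)` with `T u = μ u`. -/
def IsEigenvalue (T : E →ₗ.[ℂ] E) (μ : ℂ) : Prop := eigenspace T μ ≠ ⊥

/-- The geometric multiplicity of `μ` is the natural number `n`. -/
def HasGeometricMultiplicity (T : E →ₗ.[ℂ] E) (μ : ℂ) (n : ℕ) : Prop :=
  Module.rank ℂ (eigenspace T μ) = n

/-- The kernel of `(T - μ) ^ k` on its natural domain: `u` belongs to the `(k + 1)`-st kernel iff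
`u ∈ D(T)` and `T u - μ u` belongs to the `k`-th kernel. -/
def kerPow (T : E →ₗ.[ℂ] E) (μ : ℂ) : ℕ → Submodule ℂ E
  | 0 => ⊥
  | k + 1 => (T.graph ⊓ (kerPow T μ k).comap
      (LinearMap.snd ℂ E E - μ • LinearMap.fst ℂ E E)).map (LinearMap.fst ℂ E E)

/-- The space of generalized eigenvectors (root vectors) of `T` at `μ`. -/
def rootSpace (T : E →ₗ.[ℂ] E) (μ : ℂ) : Submodule ℂ E := ⨆ k : ℕ, kerPow T μ k

/-- The closed disc of radius `r > 0` about `μ` meets the spectrum at most in `μ`. -/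
def IsIsolatingRadius (T : E →ₗ.[ℂ] E) (μ : ℂ) (r : ℝ) : Prop :=
  0 < r ∧ Metric.closedBall μ r ∩ spec T ⊆ {μ}

/-- The Riesz projection `-(2πi)⁻¹ ∮ (T - z)⁻¹ dz` over the circle of radius `r` about `μ`. -/
def rieszProjection (T : E →ₗ.[ℂ] E) (μ : ℂ) (r : ℝ) : E →L[ℂ] E :=
  -(2 * (Real.pi : ℂ) * Complex.I)⁻¹ • ∮ z in C(μ, r), resolvent T z

/-- `μ` is isolated in the spectrum of `T` (or outside of it), and its algebraic multiplicity, the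
rank of the Riesz projection of `T` at `μ`, is the natural number `n`. -/
def HasAlgebraicMultiplicity (T : E →ₗ.[ℂ] E) (μ : ℂ) (n : ℕ) : Prop :=
  (∃ r, IsIsolatingRadius T μ r) ∧
    ∀ r, IsIsolatingRadius T μ r →
      Module.rank ℂ (LinearMap.range (rieszProjection T μ r).toLinearMap) = n

/-- Discrete spectrum: every point of the spectrum is isolated in it and has finite algebraic
multiplicity. -/
def HasDiscreteSpectrum (T : E →ₗ.[ℂ] E) : Prop :=
  ∀ μ ∈ spec T, ∃ n : ℕ, HasAlgebraicMultiplicity T μ n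

/-- Diagonalizability in the weakest usual sense: the eigenvectors of `T` span a dense subspace.
Having a Riesz basis of eigenvectors, or being similar to an operator that is diagonal in an
orthonormal basis, implies it. -/
def IsDiagonalizable (T : E →ₗ.[ℂ] E) : Prop :=
  (⨆ μ : ℂ, eigenspace T μ).topologicalClosure = ⊤

end Spectral

/-! ### The operator -/

/-- The plane `ℝ²`. -/
abbrev Plane := EuclideanSpace ℝ (Fin 2)

/-- The Hilbert space `L²(ℝ²)` of complex-valued functions. -/
abbrev L2 := Lp ℂ 2 (volume : Measure Plane)

/-- The embedding of `L²(ℝ²)` into the tempered distributions. -/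
abbrev toDist : L2 →L[ℂ] 𝓢'(Plane, ℂ) := Lp.toTemperedDistributionCLM ℂ (volume : Measure Plane) 2

/-- Multiplication of a distribution by the coordinate `x_i`. -/
def mulX (i : Fin 2) : 𝓢'(Plane, ℂ) →ₗ[ℂ] 𝓢'(Plane, ℂ) :=
  (TemperedDistribution.smulLeftCLM ℂ fun x : Plane => ((x i : ℝ) : ℂ)).toLinearMap

/-- The distributional partial derivative `∂/∂x_i`. -/
def partialX (i : Fin 2) : 𝓢'(Plane, ℂ) →ₗ[ℂ] 𝓢'(Plane, ℂ) :=
  (LineDeriv.lineDerivOpCLM ℂ 𝓢'(Plane, ℂ) (EuclideanSpace.single i (1 : ℝ))).toLinearMap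

/-- The annihilation (destruction) operator `a_i = (x_i + ∂_i) / √2`. -/
def ann (i : Fin 2) : 𝓢'(Plane, ℂ) →ₗ[ℂ] 𝓢'(Plane, ℂ) :=
  ((Real.sqrt 2 : ℝ) : ℂ)⁻¹ • (mulX i + partialX i)

/-- The creation operator `a_i^* = (x_i - ∂_i) / √2`. -/
def cre (i : Fin 2) : 𝓢'(Plane, ℂ) →ₗ[ℂ] 𝓢'(Plane, ℂ) :=
  ((Real.sqrt 2 : ℝ) : ℂ)⁻¹ • (mulX i - partialX i)

/-- The formal differential operator `a₁^* a₁ + a₂^* a₂ + i g a₂^* a₁ + 1`. -/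
def formalH (g : ℝ) : 𝓢'(Plane, ℂ) →ₗ[ℂ] 𝓢'(Plane, ℂ) :=
  cre 0 ∘ₗ ann 0 + cre 1 ∘ₗ ann 1 + (Complex.I * (g : ℂ)) • (cre 1 ∘ₗ ann 0) + LinearMap.id

/-- `D(-Δ)`: the `u ∈ L²` whose distributional Laplacian is in `L²`. -/
def laplacianDomain : Submodule ℂ L2 :=
  (LinearMap.range toDist.toLinearMap).comap
    ((LineDeriv.laplacianCLM ℂ Plane 𝓢'(Plane, ℂ)).toLinearMap ∘ₗ toDist.toLinearMap)

/-- `D(x₁² + x₂²)`: the `u ∈ L²` with `(x₁² + x₂²) u ∈ L²`. -/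
def potentialDomain : Submodule ℂ L2 :=
  (LinearMap.range toDist.toLinearMap).comap
    ((mulX 0 ∘ₗ mulX 0 + mulX 1 ∘ₗ mulX 1) ∘ₗ toDist.toLinearMap)

/-- The domain `D(H₀) = D(-Δ) ∩ D(x₁² + x₂²)` of the two-dimensional harmonic oscillator. -/
def domainH0 : Submodule ℂ L2 := laplacianDomain ⊓ potentialDomain

/-- The pairs `(u, w)` with `u ∈ D(H₀)`, `w ∈ L²` and `formalH g u = w` as distributions. -/
def graphH (g : ℝ) : Submodule ℂ (L2 × L2) :=
  domainH0.comap (LinearMap.fst ℂ L2 L2) ⊓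
    LinearMap.ker (toDist.toLinearMap ∘ₗ LinearMap.snd ℂ L2 L2 -
      formalH g ∘ₗ toDist.toLinearMap ∘ₗ LinearMap.fst ℂ L2 L2)

/-- The operator `H(g)` in `L²(ℝ²)`: it acts as `a₁^* a₁ + a₂^* a₂ + i g a₂^* a₁ + 1` on those
`u ∈ D(H₀)` for which the result is in `L²`. That these are all `u ∈ D(H₀)` needs a proof, and is
stated separately wherever it is used. -/
def H (g : ℝ) : L2 →ₗ.[ℂ] L2 := (graphH g).toLinearPMap

theorem toDist_injective : Function.Injective toDist :=
  LinearMap.ker_eq_bot.mp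
    (Lp.ker_toTemperedDistributionCLM_eq_bot (F := ℂ) (μ := (volume : Measure Plane)) (p := 2))

/-- `H(g)` really has the graph by which it is defined. -/
theorem graph_H (g : ℝ) : (H g).graph = graphH g := by
  refine Submodule.toLinearPMap_graph_eq _ ?_
  rintro ⟨u, w⟩ hx (hu : u = 0)
  subst hu
  have h : toDist w - formalH g (toDist 0) = 0 := hx.2
  rw [map_zero, map_zero, sub_zero] at h
  exact toDist_injective (h.trans (map_zero toDist).symm)

/-! ### Hermite functions -/

/-- The normalized one-dimensional Hermite function
`ψ_n(x) = (√π n!)^{-1/2} He_n(√2 x) exp(-x²/2)`, where `He_n` is the `n`-th probabilists' Hermite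
polynomial; equivalently `ψ_n(x) = (√π 2^n n!)^{-1/2} H_n(x) exp(-x²/2)` with the physicists'
Hermite polynomial `H_n`. -/
def hermiteFun (n : ℕ) (x : ℝ) : ℝ :=
  (Real.sqrt (Real.sqrt Real.pi * (n.factorial : ℝ)))⁻¹ *
    Polynomial.aeval (Real.sqrt 2 * x) (Polynomial.hermite n) * Real.exp (-x ^ 2 / 2)

theorem continuous_hermiteFun (n : ℕ) : Continuous (hermiteFun n) := by
  unfold hermiteFun
  fun_prop

theorem integrable_poly_mul_gaussian (p : Polynomial ℝ) :
    Integrable fun x : ℝ => p.eval x * Real.exp (-x ^ 2) := by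
  induction p using Polynomial.induction_on' with
  | add p q hp hq =>
    exact (hp.add hq).congr (Filter.Eventually.of_forall fun x => by simp [add_mul])
  | monomial n a =>
    have h := integrable_rpow_mul_exp_neg_mul_sq (b := 1) one_pos (s := (n : ℝ))
      (by have : (0 : ℝ) ≤ n := n.cast_nonneg
          linarith)
    simpa [mul_assoc] using h.const_mul a

theorem integrable_hermiteFun_sq (n : ℕ) : Integrable fun x : ℝ => hermiteFun n x ^ 2 := by
  set q : Polynomial ℝ := ((Polynomial.hermite n).map (algebraMap ℤ ℝ)).comp
    (Polynomial.C (Real.sqrt 2) * Polynomial.X)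
  refine ((integrable_poly_mul_gaussian (q ^ 2)).const_mul
    ((Real.sqrt (Real.sqrt Real.pi * (n.factorial : ℝ)))⁻¹ ^ 2)).congr
    (Filter.Eventually.of_forall fun x => ?_)
  have h1 : Polynomial.aeval (Real.sqrt 2 * x) (Polynomial.hermite n) = q.eval x := by
    simp [q, Polynomial.eval_comp, Polynomial.aeval_def, Polynomial.eval_map]
  have h2 : Real.exp (-x ^ 2) = Real.exp (-x ^ 2 / 2) ^ 2 := by
    rw [← Real.exp_nat_mul]
    congr 1
    push_cast
    ring
  simp only [hermiteFun, h1, h2, Polynomial.eval_pow]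
  ring

/-- The function `(x₁, x₂) ↦ ψ_j(x₁) ψ_k(x₂)`. -/
def hermiteProd (j k : ℕ) (x : Plane) : ℂ := ((hermiteFun j (x 0) * hermiteFun k (x 1) : ℝ) : ℂ)

theorem memLp_hermiteProd (j k : ℕ) : MemLp (hermiteProd j k) 2 (volume : Measure Plane) := by
  have hc : Continuous fun x : Plane => hermiteFun j (x 0) * hermiteFun k (x 1) := by
    have := continuous_hermiteFun j
    have := continuous_hermiteFun k
    fun_prop
  suffices hr : MemLp (fun x : Plane => hermiteFun j (x 0) * hermiteFun k (x 1)) 2 volume from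
    hr.ofReal
  rw [memLp_two_iff_integrable_sq hc.aestronglyMeasurable]
  have h := Integrable.fintype_prod (μ := fun _ : Fin 2 => (volume : Measure ℝ))
    (f := ![fun x : ℝ => hermiteFun j x ^ 2, fun x : ℝ => hermiteFun k x ^ 2])
    (by intro i; fin_cases i <;> simp [integrable_hermiteFun_sq])
  have h' := (EuclideanSpace.volume_preserving_symm_measurableEquiv_toLp
    (Fin 2)).integrable_comp_of_integrable h
  refine h'.congr (Filter.Eventually.of_forall fun x => ?_)
  simp [Fin.prod_univ_two, mul_pow]

/-- The vectors `φ_{m,h}(x₁, x₂) = ψ_h(x₁) ψ_{m-h}(x₂)`, `h = 0, …, m`, of `L²(ℝ²)`. -/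
def phi (m : ℕ) (h : Fin (m + 1)) : L2 := (memLp_hermiteProd h (m - h)).toLp

/-- The span of the products of Hermite functions of total degree `m`. -/
def Hm (m : ℕ) : Submodule ℂ L2 := Submodule.span ℂ (Set.range (phi m))

instance (m : ℕ) : FiniteDimensional ℂ (Hm m) :=
  FiniteDimensional.span_of_finite ℂ (Set.finite_range _)

/-- The `(m+1) × (m+1)` matrix whose only nonzero entries are, on the first superdiagonal,
`√m, √(2(m-1)), √(3(m-2)), …, √m`. -/
def D (m : ℕ) : Matrix (Fin (m + 1)) (Fin (m + 1)) ℂ := fun i j =>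
  if (j : ℕ) = i + 1 then ((Real.sqrt (((i : ℝ) + 1) * ((m : ℝ) - i)) : ℝ) : ℂ) else 0

/-- The operator `T` is the orthogonal direct sum `⨁ S_m` of the operators `S_m` on the `Hm m`:
`D(T)` consists of the `u` with `∑ ‖S_m P_m u‖² < ∞`, and `T u = ∑ S_m P_m u` there, where `P_m` is
the orthogonal projection onto `Hm m`. -/
def IsDirectSum (T : L2 →ₗ.[ℂ] L2) (S : ∀ m, Module.End ℂ (Hm m)) : Prop :=
  (∀ u : L2, u ∈ T.domain ↔
    Summable fun m => ‖S m ((Hm m).orthogonalProjectionOnto u)‖ ^ 2) ∧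
  ∀ u : T.domain,
    HasSum (fun m => (S m ((Hm m).orthogonalProjectionOnto (u : L2)) : L2)) (T u)

end PTOscillator

end

open PTOscillator

noncomputable section

namespace PTOscillator

/-! ### Resolvents and kernels of powers -/

section General

variable {E : Type*} [NormedAddCommGroup E] [NormedSpace ℂ E] {T : E →ₗ.[ℂ] E}

/-! The products of Hermite functions diagonalize `H(0)`: the number part acts on `Hm m` as the
scalar m + 1. The exchange term a₂^* a₁ sends φ_{m,h} to √(h(m-h+1)) φ_{m,h-1}, so it preserves
total degree and is nilpotent on each `Hm m`. Thus `H(g)` is formally a direct sum of blocks (m + 1)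
+ N_m, where N_m is ig times a weighted shift; for g ≠ 0 this is one Jordan block, with kernel
spanned by φ_{m,0}.

The analytic point is uniformity in m. By the arithmetic-geometric mean inequality the weights are
at most (m + 1)/2 (`superdiag_le`), whence ‖N_m‖ ≤ (|g|/2)(m + 1). Since |g| < 2, the perturbation
is relatively bounded by q = |g|/2 < 1. Consequently ‖block v‖ is comparable to (m + 1)‖v‖, which
identifies D(H₀) with the domain of the direct sum (`mem_domain_H_iff`, `isBlockSum_H`); and for z
outside {m + 1} the blocks minus z are bounded below uniformly in m (`exists_lower_bound`), so their
inverses assemble into a bounded resolvent. On a single block the resolvent is a finite Neumann sum,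
so residues give the Riesz projection, which is the orthogonal projection onto `Hm m`
(`range_rieszProjection`).

The link with distributions is duality: a_i and a_i^* are transposes of each other and act on
Hermite functions by explicit weights. This yields orthonormality and describes D(H₀) by Hermite
coefficients (`mem_domainH0_iff`). Completeness is the classical Fourier argument: if u is
orthogonal to every Hermite function, all moments of u times a Gaussian vanish, hence so does its
Fourier transform. -/

theorem mem_kerPow_succ {μ : ℂ} {k : ℕ} {u : E} :
    u ∈ kerPow T μ (k + 1) ↔ ∃ h : u ∈ T.domain, T ⟨u, h⟩ - μ • u ∈ kerPow T μ k := by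
  simp only [kerPow, Submodule.mem_map, Submodule.mem_inf, Submodule.mem_comap,
    LinearPMap.mem_graph_iff, Prod.exists]
  constructor
  · rintro ⟨a, b, ⟨⟨y, hy, hb⟩, hk⟩, hu⟩
    simp only [LinearMap.fst_apply] at hu
    subst hu hy hb
    exact ⟨y.2, by simpa using hk⟩
  · rintro ⟨h, hk⟩
    exact ⟨u, T ⟨u, h⟩, ⟨⟨⟨u, h⟩, rfl, rfl⟩, by simpa using hk⟩, rfl⟩

theorem mem_eigenspace {μ : ℂ} {u : E} :
    u ∈ eigenspace T μ ↔ ∃ h : u ∈ T.domain, T ⟨u, h⟩ = μ • u := by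
  simp only [eigenspace, Submodule.mem_comap, LinearPMap.mem_graph_iff, LinearMap.prod_apply]
  constructor
  · rintro ⟨y, rfl, h2⟩
    exact ⟨y.2, h2⟩
  · rintro ⟨h, h2⟩
    exact ⟨⟨u, h⟩, rfl, h2⟩

theorem eigenspace_eq_kerPow_one (μ : ℂ) : eigenspace T μ = kerPow T μ 1 := by
  ext u
  rw [mem_eigenspace, mem_kerPow_succ]
  simp [kerPow, sub_eq_zero]

theorem isResolventAt_resolvent {z : ℂ} (hz : z ∈ resolventSet T) :
    IsResolventAt T z (resolvent T z) := by
  have hz' : ∃ R : E →L[ℂ] E, IsResolventAt T z R := hz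
  rw [resolvent, dif_pos hz']
  exact hz'.choose_spec

/-- First resolvent identity: apply the left-inverse property at z to the vector `resolvent T w v`.
-/
theorem resolvent_sub_resolvent {z w : ℂ} (hz : z ∈ resolventSet T) (hw : w ∈ resolventSet T) :
    resolvent T z - resolvent T w = (z - w) • (resolvent T z ∘L resolvent T w) := by
  ext v
  obtain ⟨h, hv⟩ := (isResolventAt_resolvent hw).1 v
  have h2 := (isResolventAt_resolvent hz).2 ⟨_, h⟩
  have h3 : T ⟨_, h⟩ - z • resolvent T w v = v - (z - w) • resolvent T w v := by
    nth_rewrite 3 [← hv]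
    module
  rw [h3, map_sub, map_smul] at h2
  change _ - (z - w) • _ = resolvent T w v at h2
  simp only [sub_apply, smul_apply, ContinuousLinearMap.comp_apply]
  rw [sub_eq_iff_eq_add] at h2 ⊢
  rw [h2, add_comm]

/-- Continuity suffices for the contour integrals below, because they are evaluated on vectors of a
block, where the resolvent is explicit; holomorphy is never used. -/
theorem continuousOn_resolvent : ContinuousOn (resolvent T) (resolventSet T) := by
  intro w hw
  set r := ‖resolvent T w‖
  have key : ∀ z ∈ resolventSet T, ‖z - w‖ * r ≤ 1 / 2 →
      ‖resolvent T z - resolvent T w‖ ≤ ‖z - w‖ * (2 * r * r) := by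
    intro z hz hzw
    have h1 : ‖resolvent T z - resolvent T w‖ ≤ ‖z - w‖ * (‖resolvent T z‖ * r) := by
      rw [resolvent_sub_resolvent hz hw, norm_smul]
      gcongr
      exact ContinuousLinearMap.opNorm_comp_le _ _
    have h2 : ‖resolvent T z‖ ≤ r + ‖resolvent T z - resolvent T w‖ := by
      simpa using norm_add_le (resolvent T w) (resolvent T z - resolvent T w)
    -- With ‖z - w‖ r ≤ 1/2, the two bounds give ‖R(z)‖ ≤ r + ‖R(z)‖/2, and the last term is
    -- absorbed.
    have h3 : ‖resolvent T z‖ ≤ 2 * r := by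
      nlinarith [norm_nonneg (resolvent T z)]
    refine h1.trans ?_
    gcongr
  have hc : Filter.Tendsto (fun z => ‖z - w‖) (nhdsWithin w (resolventSet T)) (nhds 0) := by
    have : Continuous fun z : ℂ => ‖z - w‖ := by fun_prop
    simpa using this.continuousWithinAt (s := resolventSet T) (x := w) |>.tendsto
  refine tendsto_iff_norm_sub_tendsto_zero.mpr ?_
  refine squeeze_zero' (Filter.Eventually.of_forall fun _ => norm_nonneg _) ?_
    (by simpa using hc.mul_const (2 * r * r))
  have hs : ∀ᶠ z in nhdsWithin w (resolventSet T), ‖z - w‖ * r < 1 / 2 := by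
    have := hc.mul_const r
    rw [zero_mul] at this
    exact this.eventually_lt_const (by norm_num)
  filter_upwards [hs, self_mem_nhdsWithin] with z hz hz'
  exact key z hz' hz.le

theorem IsEigenvalue.mem_spec {μ : ℂ} (h : IsEigenvalue T μ) : μ ∈ spec T := by
  rintro ⟨R, hR⟩
  refine h ((Submodule.eq_bot_iff _).2 fun u hu => ?_)
  obtain ⟨hd, hu⟩ := mem_eigenspace.1 hu
  have := hR.2 ⟨u, hd⟩
  rw [hu] at this
  simpa using this.symm

end General

/-! ### Orthogonal direct sums of operators on finite-dimensional spaces -/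

section Blocks

variable {E : Type*} [NormedAddCommGroup E] [InnerProductSpace ℂ E] [CompleteSpace E]
  {V : ℕ → Submodule ℂ E}

theorem summable_coe_of_norm_sq
    (hV : IsHilbertSum ℂ (fun m => V m) fun m => (V m).subtypeₗᵢ) {w : ∀ m, V m}
    (hw : Summable fun m => ‖w m‖ ^ 2) : Summable fun m => (w m : E) :=
  (hV.OrthogonalFamily.summable_iff_norm_sq_summable w).2 hw

variable [∀ m, FiniteDimensional ℂ (V m)]

theorem proj_of_hasSum (hV : IsHilbertSum ℂ (fun m => V m) fun m => (V m).subtypeₗᵢ)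
    {w : ∀ m, V m} {u : E} (hw : HasSum (fun m => (w m : E)) u) (n : ℕ) :
    (V n).orthogonalProjectionOnto u = w n := by
  have h := hw.mapL (V n).orthogonalProjectionOnto
  refine h.unique ?_
  have h2 := hasSum_single (f := fun m => (V n).orthogonalProjectionOnto (w m : E)) n ?_
  · simpa using h2
  · intro m hm
    rw [Submodule.orthogonalProjectionOnto_eq_zero_iff]
    intro x hx
    exact hV.OrthogonalFamily hm.symm ⟨x, hx⟩ (w m)

theorem proj_coe_ne (hV : IsHilbertSum ℂ (fun m => V m) fun m => (V m).subtypeₗᵢ)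
    {m n : ℕ} (hmn : m ≠ n) (v : V n) : (V m).orthogonalProjectionOnto (v : E) = 0 := by
  rw [Submodule.orthogonalProjectionOnto_eq_zero_iff]
  intro x hx
  exact hV.OrthogonalFamily hmn ⟨x, hx⟩ v

/-- The abstract coordinates of the Hilbert sum are identified with the orthogonal projections, in
terms of which everything later is phrased. -/
theorem hasSum_proj (hV : IsHilbertSum ℂ (fun m => V m) fun m => (V m).subtypeₗᵢ) (u : E) :
    HasSum (fun m => ((V m).orthogonalProjectionOnto u : E)) u := by
  have h := hV.hasSum_linearIsometryEquiv_symm (hV.linearIsometryEquiv u)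
  rw [LinearIsometryEquiv.symm_apply_apply] at h
  have h2 := proj_of_hasSum hV (w := fun m => hV.linearIsometryEquiv u m) h
  simp_rw [h2]
  exact h

theorem summable_norm_sq_proj (hV : IsHilbertSum ℂ (fun m => V m) fun m => (V m).subtypeₗᵢ)
    (u : E) : Summable fun m => ‖(V m).orthogonalProjectionOnto u‖ ^ 2 :=
  (hV.OrthogonalFamily.summable_iff_norm_sq_summable _).1 (hasSum_proj hV u).summable

theorem eq_of_proj_eq (hV : IsHilbertSum ℂ (fun m => V m) fun m => (V m).subtypeₗᵢ) {u v : E}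
    (h : ∀ m, (V m).orthogonalProjectionOnto u = (V m).orthogonalProjectionOnto v) : u = v := by
  have hu := hasSum_proj hV u
  simp_rw [h] at hu
  exact hu.unique (hasSum_proj hV v)

theorem hasSum_norm_sq_proj (hV : IsHilbertSum ℂ (fun m => V m) fun m => (V m).subtypeₗᵢ)
    (u : E) : HasSum (fun m => ‖(V m).orthogonalProjectionOnto u‖ ^ 2) (‖u‖ ^ 2) := by
  have h := hasSum_proj hV u
  have h2 := ((h.norm.pow 2 : Filter.Tendsto _ _ _))
  refine h2.congr fun s => ?_
  exact hV.OrthogonalFamily.norm_sum (fun m => (V m).orthogonalProjectionOnto u) s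

/-- The block-diagonal operator with uniformly bounded blocks `R m`. -/
theorem exists_blockDiagonal (hV : IsHilbertSum ℂ (fun m => V m) fun m => (V m).subtypeₗᵢ)
    (R : ∀ m, Module.End ℂ (V m)) {C : ℝ} (hC : ∀ m v, ‖R m v‖ ≤ C * ‖v‖) :
    ∃ A : E →L[ℂ] E, ∀ m u, (V m).orthogonalProjectionOnto (A u) =
      R m ((V m).orthogonalProjectionOnto u) := by
  have hb : ∀ m u, ‖R m ((V m).orthogonalProjectionOnto u)‖ ^ 2 ≤
      C ^ 2 * ‖(V m).orthogonalProjectionOnto u‖ ^ 2 := by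
    intro m u
    rw [← mul_pow]
    exact pow_le_pow_left₀ (norm_nonneg _) (hC _ _) 2
  have hs : ∀ u, Summable fun m => (R m ((V m).orthogonalProjectionOnto u) : E) := fun u =>
    summable_coe_of_norm_sq hV (Summable.of_nonneg_of_le (fun _ => by positivity) (fun m => hb m u)
      ((summable_norm_sq_proj hV u).mul_left _))
  have hP : ∀ u n, (V n).orthogonalProjectionOnto
      (∑' m, (R m ((V m).orthogonalProjectionOnto u) : E)) =
      R n ((V n).orthogonalProjectionOnto u) := fun u n =>
    proj_of_hasSum hV (w := fun m => R m ((V m).orthogonalProjectionOnto u)) (hs u).hasSum n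
  let A : E →ₗ[ℂ] E :=
    { toFun := fun u => ∑' m, (R m ((V m).orthogonalProjectionOnto u) : E)
      map_add' := fun u v => eq_of_proj_eq hV fun m => by rw [map_add, hP, hP, hP, map_add, map_add]
      map_smul' := fun c u => eq_of_proj_eq hV fun m => by
        rw [RingHom.id_apply, map_smul, hP, hP, map_smul, map_smul] }
  refine ⟨A.mkContinuous |C| fun u => ?_, fun m u => hP u m⟩
  refine abs_le_of_sq_le_sq' ?_ (by positivity) |>.2
  rw [mul_pow, sq_abs]
  have h1 := hasSum_norm_sq_proj hV (A u)
  have h2 := (hasSum_norm_sq_proj hV u).mul_left (C ^ 2)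
  refine hasSum_le (fun m => ?_) h1 h2
  change ‖(V m).orthogonalProjectionOnto (∑' m, (R m ((V m).orthogonalProjectionOnto u) : E))‖ ^ 2
    ≤ _
  rw [hP]
  exact hb m u

/-- `T` is the orthogonal direct sum of the operators `S m` on the spaces `V m`. -/
def IsBlockSum (T : E →ₗ.[ℂ] E) (S : ∀ m, Module.End ℂ (V m)) : Prop :=
  (∀ u : E, u ∈ T.domain ↔
    Summable fun m => ‖S m ((V m).orthogonalProjectionOnto u)‖ ^ 2) ∧
  ∀ u : T.domain,
    HasSum (fun m => (S m ((V m).orthogonalProjectionOnto (u : E)) : E)) (T u)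

variable {T : E →ₗ.[ℂ] E} {S : ∀ m, Module.End ℂ (V m)}

theorem IsBlockSum.proj_apply (hT : IsBlockSum T S)
    (hV : IsHilbertSum ℂ (fun m => V m) fun m => (V m).subtypeₗᵢ) (n : ℕ) (u : T.domain) :
    (V n).orthogonalProjectionOnto (T u) = S n ((V n).orthogonalProjectionOnto (u : E)) :=
  proj_of_hasSum hV (hT.2 u) n

theorem IsBlockSum.coe_mem_domain (hT : IsBlockSum T S)
    (hV : IsHilbertSum ℂ (fun m => V m) fun m => (V m).subtypeₗᵢ) {n : ℕ} (v : V n) :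
    (v : E) ∈ T.domain := by
  rw [hT.1]
  refine summable_of_ne_finset_zero (s := {n}) fun m hm => ?_
  rw [proj_coe_ne hV (by simpa using hm) v]
  simp

theorem IsBlockSum.apply_coe (hT : IsBlockSum T S)
    (hV : IsHilbertSum ℂ (fun m => V m) fun m => (V m).subtypeₗᵢ) {n : ℕ} (v : V n)
    (h : (v : E) ∈ T.domain) : T ⟨v, h⟩ = S n v := by
  refine eq_of_proj_eq hV fun m => ?_
  rw [hT.proj_apply hV]
  by_cases hmn : m = n
  · subst hmn
    simp
  · rw [proj_coe_ne hV hmn, proj_coe_ne hV hmn, map_zero]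

theorem IsBlockSum.proj_resolvent (hT : IsBlockSum T S)
    (hV : IsHilbertSum ℂ (fun m => V m) fun m => (V m).subtypeₗᵢ) {z : ℂ} {R : E →L[ℂ] E}
    (hR : IsResolventAt T z R) {n : ℕ} {v w : V n} (hw : S n w - z • w = v) :
    R v = w := by
  have h := hR.2 ⟨w, hT.coe_mem_domain hV w⟩
  rw [hT.apply_coe hV] at h
  rw [← hw]
  simpa using h

/-- In finite dimension the lower bound makes each S_m - z bijective with inverse of norm at most
δ⁻¹; uniformity in m lets the inverses form one bounded block-diagonal operator. -/
theorem IsBlockSum.mem_resolventSet (hT : IsBlockSum T S)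
    (hV : IsHilbertSum ℂ (fun m => V m) fun m => (V m).subtypeₗᵢ) {z : ℂ} {δ : ℝ} (hδ : 0 < δ)
    (h : ∀ m v, δ * ‖v‖ ≤ ‖S m v - z • v‖) : z ∈ resolventSet T := by
  have hinj : ∀ m, Function.Injective (S m - z • (1 : Module.End ℂ (V m))) := by
    intro m
    rw [injective_iff_map_eq_zero]
    intro v hv
    have h1 := h m v
    have h2 : S m v - z • v = 0 := hv
    rw [h2, norm_zero] at h1
    have : ‖v‖ ≤ 0 := by nlinarith [norm_nonneg v]
    simpa using this
  let e : ∀ m, V m ≃ₗ[ℂ] V m := fun m => LinearEquiv.ofInjectiveEndo _ (hinj m)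
  have he : ∀ m v, e m v = S m v - z • v := fun m v => rfl
  obtain ⟨A, hA⟩ := exists_blockDiagonal hV (fun m => ((e m).symm : V m →ₗ[ℂ] V m)) (C := δ⁻¹) (by
    intro m v
    have := h m ((e m).symm v)
    rw [← he, LinearEquiv.apply_symm_apply] at this
    rw [inv_mul_eq_div, le_div_iff₀ hδ, mul_comm]
    exact this)
  have hA' : ∀ m u, S m ((V m).orthogonalProjectionOnto (A u)) =
      (V m).orthogonalProjectionOnto u + z • (V m).orthogonalProjectionOnto (A u) := by
    intro m u
    rw [← sub_eq_iff_eq_add, ← he, hA]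
    exact (e m).apply_symm_apply _
  refine ⟨A, fun u => ?_, fun u => ?_⟩
  · have hd : A u ∈ T.domain := by
      rw [hT.1]
      -- S_m P_m A u is the projection of the fixed vector u + z A u, so its norms are square
      -- summable.
      simp_rw [hA', ← map_smul, ← map_add]
      exact summable_norm_sq_proj hV _
    refine ⟨hd, eq_of_proj_eq hV fun m => ?_⟩
    rw [map_sub, hT.proj_apply hV, map_smul, hA']
    abel
  · refine eq_of_proj_eq hV fun m => ?_
    rw [hA, map_sub, hT.proj_apply hV, map_smul, ← he]
    exact (e m).symm_apply_apply _

/-! ### Blocks of the form (m + 1) + nilpotent -/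

section Nilpotent

variable {N : ∀ m, Module.End ℂ (V m)} {q : ℝ}

/-- N v = -a v iterates to N^k v = (-a)^k v, and a nilpotent map has no nonzero eigenvalue. -/
theorem sub_smul_eq_zero_of_nilpotent {M : Type*} [AddCommGroup M] [Module ℂ M]
    {N : Module.End ℂ M} (hN : IsNilpotent N) {a : ℂ} (ha : a ≠ 0) {v : M}
    (h : a • v + N v = 0) : v = 0 := by
  obtain ⟨k, hk⟩ := hN
  have h1 : ∀ j : ℕ, (N ^ j) v = (-a) ^ j • v := by
    intro j
    induction j with
    | zero => simp
    | succ j ih =>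
      rw [pow_succ', Module.End.mul_apply, ih, map_smul, eq_neg_of_add_eq_zero_right h, pow_succ]
      module
  have h2 := h1 k
  rw [hk, LinearMap.zero_apply] at h2
  exact (smul_eq_zero.1 h2.symm).resolve_left (pow_ne_zero _ (neg_ne_zero.2 ha))

theorem natCast_add_one_sub_ne_zero {z : ℂ} (hz : z ∉ Set.range fun m : ℕ => (m : ℂ) + 1) (m : ℕ) :
    (m : ℂ) + 1 - z ≠ 0 := fun h => hz ⟨m, sub_eq_zero.1 h⟩

/-- For large m the scalar m + 1 - z dominates N_m since q < 1; the finitely many remaining blocks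
are injective by nilpotency, hence bounded below by finite dimension. -/
theorem exists_lower_bound (hS : ∀ m v, S m v = ((m : ℂ) + 1) • v + N m v)
    (hN : ∀ m, IsNilpotent (N m)) (hq : q < 1) (hNq : ∀ m v, ‖N m v‖ ≤ q * (m + 1) * ‖v‖)
    {z : ℂ} (hz : z ∉ Set.range fun m : ℕ => (m : ℂ) + 1) :
    ∃ δ : ℝ, 0 < δ ∧ ∀ m v, δ * ‖v‖ ≤ ‖S m v - z • v‖ := by
  have hSz : ∀ m v, S m v - z • v = ((m : ℂ) + 1 - z) • v + N m v := by
    intro m v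
    rw [hS]
    module
  have h1 : ∀ m : ℕ, ∃ δ : ℝ, 0 < δ ∧ ∀ v, δ * ‖v‖ ≤ ‖S m v - z • v‖ := by
    intro m
    have hk : LinearMap.ker (S m - z • (1 : Module.End ℂ (V m))) = ⊥ := by
      rw [LinearMap.ker_eq_bot']
      intro v hv
      refine sub_smul_eq_zero_of_nilpotent (hN m) (natCast_add_one_sub_ne_zero hz m) ?_
      rw [← hSz]
      exact hv
    obtain ⟨K, hK, hK2⟩ := LinearMap.exists_antilipschitzWith _ hk
    refine ⟨(K : ℝ)⁻¹, by positivity, fun v => ?_⟩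
    have := hK2.le_mul_norm (map_zero _) v
    rw [inv_mul_le_iff₀ (by positivity)]
    simpa using this
  choose δ hδ hδ2 using h1
  -- This choice makes (m + 1)(1 - q) exceed ‖z‖ + 1 for all m ≥ M, so the constant 1 works for
  -- those blocks.
  obtain ⟨M, hM⟩ := exists_nat_gt ((‖z‖ + 1) / (1 - q))
  have hM' : ∀ m : ℕ, M ≤ m → ∀ v, 1 * ‖v‖ ≤ ‖S m v - z • v‖ := by
    intro m hm v
    rw [hSz]
    have h2 : (m : ℝ) + 1 - ‖z‖ ≤ ‖(m : ℂ) + 1 - z‖ := by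
      have h3 := norm_sub_norm_le ((m : ℂ) + 1) z
      have h4 : ‖(m : ℂ) + 1‖ = (m : ℝ) + 1 := by
        rw [← Nat.cast_add_one, Complex.norm_natCast]
        push_cast
        rfl
      linarith
    have h5 : ‖((m : ℂ) + 1 - z) • v‖ - ‖N m v‖ ≤ ‖((m : ℂ) + 1 - z) • v + N m v‖ := by
      have := norm_sub_le (((m : ℂ) + 1 - z) • v + N m v) (N m v)
      rw [add_sub_cancel_right] at this
      linarith
    rw [norm_smul] at h5
    have h6 : ‖z‖ + 1 < (m + 1) * (1 - q) := by
      rw [div_lt_iff₀ (by linarith)] at hM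
      have : (M : ℝ) ≤ m := by exact_mod_cast hm
      nlinarith
    have h7 := hNq m v
    have h8 := norm_nonneg v
    nlinarith [mul_le_mul_of_nonneg_right h2 h8]
  -- The index M, where `f` takes the value 1, stands for all m ≥ M in the minimum over 0, …, M.
  let f : ℕ → ℝ := fun m => if m < M then δ m else 1
  obtain ⟨m₀, -, hm₀⟩ := (Finset.range (M + 1)).exists_min_image f ⟨0, by simp⟩
  have hf : ∀ m, 0 < f m := by
    intro m
    simp only [f]
    split_ifs
    exacts [hδ m, one_pos]
  refine ⟨f m₀, hf m₀, fun m v => ?_⟩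
  by_cases hm : m < M
  · have := hm₀ m (by simp; omega)
    simp only [f, if_pos hm] at this
    exact (mul_le_mul_of_nonneg_right this (norm_nonneg v)).trans (hδ2 m v)
  · have := hm₀ M (by simp)
    simp only [f, lt_irrefl, if_false] at this
    exact (mul_le_mul_of_nonneg_right this (norm_nonneg v)).trans (hM' m (not_lt.1 hm) v)

theorem exists_ne_zero_mem_ker_of_nilpotent {M : Type*} [AddCommGroup M] [Module ℂ M]
    [Nontrivial M] {N : Module.End ℂ M} (hN : IsNilpotent N) : ∃ v, v ≠ 0 ∧ N v = 0 := by
  by_contra! h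
  have hinj : Function.Injective N := by
    rw [injective_iff_map_eq_zero]
    intro v hv
    by_contra h0
    exact h v h0 hv
  obtain ⟨k, hk⟩ := hN
  obtain ⟨v, hv⟩ := exists_ne (0 : M)
  refine hv ((hinj.iterate k) ?_)
  rw [← Module.End.coe_pow, hk]
  simp

theorem IsBlockSum.mem_eigenspace_coe (hT : IsBlockSum T S)
    (hV : IsHilbertSum ℂ (fun m => V m) fun m => (V m).subtypeₗᵢ)
    (hS : ∀ m v, S m v = ((m : ℂ) + 1) • v + N m v) {m : ℕ} {v : V m} (hv : N m v = 0) :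
    (v : E) ∈ eigenspace T ((m : ℂ) + 1) := by
  rw [mem_eigenspace]
  refine ⟨hT.coe_mem_domain hV v, ?_⟩
  rw [hT.apply_coe hV, hS, hv, add_zero]
  simp

theorem IsBlockSum.isEigenvalue (hT : IsBlockSum T S)
    (hV : IsHilbertSum ℂ (fun m => V m) fun m => (V m).subtypeₗᵢ)
    (hS : ∀ m v, S m v = ((m : ℂ) + 1) • v + N m v) (hN : ∀ m, IsNilpotent (N m))
    (hV0 : ∀ m, Nontrivial (V m)) (m : ℕ) : IsEigenvalue T ((m : ℂ) + 1) := by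
  obtain ⟨v, hv, hv0⟩ := exists_ne_zero_mem_ker_of_nilpotent (hN m)
  intro h
  have := hT.mem_eigenspace_coe hV hS hv0
  rw [h] at this
  exact hv (by simpa using this)

theorem IsBlockSum.spec_eq (hT : IsBlockSum T S)
    (hV : IsHilbertSum ℂ (fun m => V m) fun m => (V m).subtypeₗᵢ)
    (hS : ∀ m v, S m v = ((m : ℂ) + 1) • v + N m v) (hN : ∀ m, IsNilpotent (N m))
    (hV0 : ∀ m, Nontrivial (V m)) (hq : q < 1)
    (hNq : ∀ m v, ‖N m v‖ ≤ q * (m + 1) * ‖v‖) :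
    spec T = Set.range fun m : ℕ => (m : ℂ) + 1 := by
  ext z
  constructor
  · intro hz
    by_contra h
    obtain ⟨δ, hδ, h2⟩ := exists_lower_bound hS hN hq hNq h
    exact hz (hT.mem_resolventSet hV hδ h2)
  · rintro ⟨m, rfl⟩
    exact (hT.isEigenvalue hV hS hN hV0 m).mem_spec

theorem IsBlockSum.setOf_isEigenvalue (hT : IsBlockSum T S)
    (hV : IsHilbertSum ℂ (fun m => V m) fun m => (V m).subtypeₗᵢ)
    (hS : ∀ m v, S m v = ((m : ℂ) + 1) • v + N m v) (hN : ∀ m, IsNilpotent (N m))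
    (hV0 : ∀ m, Nontrivial (V m)) (hq : q < 1)
    (hNq : ∀ m v, ‖N m v‖ ≤ q * (m + 1) * ‖v‖) :
    {μ | IsEigenvalue T μ} = Set.range fun m : ℕ => (m : ℂ) + 1 := by
  refine Set.Subset.antisymm (fun μ hμ => ?_) ?_
  · rw [← hT.spec_eq hV hS hN hV0 hq hNq]
    exact IsEigenvalue.mem_spec hμ
  · rintro _ ⟨m, rfl⟩
    exact hT.isEigenvalue hV hS hN hV0 m

/-- Components of generalized eigenvectors in the other blocks vanish. -/
theorem IsBlockSum.proj_eq_zero_of_mem_kerPow (hT : IsBlockSum T S)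
    (hV : IsHilbertSum ℂ (fun m => V m) fun m => (V m).subtypeₗᵢ)
    (hS : ∀ m v, S m v = ((m : ℂ) + 1) • v + N m v) (hN : ∀ m, IsNilpotent (N m))
    {μ : ℂ} {n : ℕ} (hn : (n : ℂ) + 1 ≠ μ) {k : ℕ} {u : E} (hu : u ∈ kerPow T μ k) :
    (V n).orthogonalProjectionOnto u = 0 := by
  induction k generalizing u with
  | zero =>
    have : u = 0 := hu
    simp [this]
  | succ k ih =>
    obtain ⟨hd, hk⟩ := mem_kerPow_succ.1 hu
    have := ih hk
    rw [map_sub, hT.proj_apply hV, map_smul, hS] at this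
    refine sub_smul_eq_zero_of_nilpotent (hN n) (sub_ne_zero.2 hn) ?_
    rw [← this]
    module

theorem IsBlockSum.kerPow_le (hT : IsBlockSum T S)
    (hV : IsHilbertSum ℂ (fun m => V m) fun m => (V m).subtypeₗᵢ)
    (hS : ∀ m v, S m v = ((m : ℂ) + 1) • v + N m v) (hN : ∀ m, IsNilpotent (N m))
    (m k : ℕ) : kerPow T ((m : ℂ) + 1) k ≤ V m := by
  intro u hu
  have : u = (V m).orthogonalProjectionOnto u := by
    refine eq_of_proj_eq hV fun n => ?_
    by_cases hmn : n = m
    · subst hmn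
      rw [Submodule.orthogonalProjectionOnto_mem_subspace_eq_self]
    · rw [proj_coe_ne hV hmn]
      exact hT.proj_eq_zero_of_mem_kerPow hV hS hN (by simpa using hmn) hu
  rw [this]
  exact Subtype.coe_prop _

theorem IsBlockSum.mem_kerPow_of_pow_eq_zero (hT : IsBlockSum T S)
    (hV : IsHilbertSum ℂ (fun m => V m) fun m => (V m).subtypeₗᵢ)
    (hS : ∀ m v, S m v = ((m : ℂ) + 1) • v + N m v) {m : ℕ} (k : ℕ) {v : V m}
    (hv : (N m ^ k) v = 0) : (v : E) ∈ kerPow T ((m : ℂ) + 1) k := by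
  induction k generalizing v with
  | zero =>
    have : v = 0 := by simpa using hv
    simp [this]
  | succ k ih =>
    rw [mem_kerPow_succ]
    refine ⟨hT.coe_mem_domain hV v, ?_⟩
    rw [hT.apply_coe hV, hS]
    have := ih (v := N m v) (by rwa [pow_succ] at hv)
    convert this using 1
    simp

/-- A root vector has no component in a block with a different eigenvalue, while nilpotency makes
every vector of `V m` a root vector. -/
theorem IsBlockSum.rootSpace_eq (hT : IsBlockSum T S)
    (hV : IsHilbertSum ℂ (fun m => V m) fun m => (V m).subtypeₗᵢ)
    (hS : ∀ m v, S m v = ((m : ℂ) + 1) • v + N m v) (hN : ∀ m, IsNilpotent (N m)) (m : ℕ) :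
    rootSpace T ((m : ℂ) + 1) = V m := by
  refine le_antisymm (iSup_le fun k => hT.kerPow_le hV hS hN m k) fun v hv => ?_
  obtain ⟨k, hk⟩ := hN m
  refine Submodule.mem_iSup_of_mem k (hT.mem_kerPow_of_pow_eq_zero hV hS k (v := ⟨v, hv⟩) ?_)
  simp [hk]

theorem IsBlockSum.eigenspace_eq (hT : IsBlockSum T S)
    (hV : IsHilbertSum ℂ (fun m => V m) fun m => (V m).subtypeₗᵢ)
    (hS : ∀ m v, S m v = ((m : ℂ) + 1) • v + N m v) (hN : ∀ m, IsNilpotent (N m)) (m : ℕ) :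
    eigenspace T ((m : ℂ) + 1) = (LinearMap.ker (N m)).map (V m).subtype := by
  ext u
  constructor
  · intro hu
    have hu' := hu
    rw [eigenspace_eq_kerPow_one] at hu'
    have hm := hT.kerPow_le hV hS hN m 1 hu'
    refine ⟨⟨u, hm⟩, ?_, rfl⟩
    obtain ⟨hd, h⟩ := mem_eigenspace.1 hu
    rw [hT.apply_coe hV ⟨u, hm⟩, hS] at h
    simpa using h
  · rintro ⟨v, hv, rfl⟩
    exact hT.mem_eigenspace_coe hV hS hv

end Nilpotent

end Blocks

/-! ### Riesz projections of block sums -/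

section Riesz

theorem circleIntegral_inv_pow_succ_self (c : ℂ) {r : ℝ} (hr : 0 < r) (k : ℕ) :
    (∮ z in C(c, r), ((z - c)⁻¹ ^ (k + 1))) = if k = 0 then 2 * (Real.pi : ℂ) * Complex.I else 0 := by
  split_ifs with h
  · subst h
    simpa using circleIntegral.integral_sub_center_inv c hr.ne'
  · have := circleIntegral.integral_sub_zpow_of_ne (n := -((k : ℤ) + 1)) (by omega) c c r
    rw [← this]
    congr 1
    ext z
    rw [inv_pow, zpow_neg]
    norm_cast

theorem circleIntegral_inv_pow_of_notMem {c w : ℂ} {r : ℝ} (hr : 0 < r)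
    (hw : w ∉ Metric.closedBall c r) (k : ℕ) :
    (∮ z in C(c, r), ((z - w)⁻¹ ^ k)) = 0 := by
  have hne : ∀ z ∈ Metric.closedBall c r, z - w ≠ 0 := by
    intro z hz h
    rw [sub_eq_zero.1 h] at hz
    exact hw hz
  refine Complex.circleIntegral_eq_zero_of_differentiable_on_off_countable hr.le
    Set.countable_empty ?_ ?_
  · exact ((continuousOn_id.sub continuousOn_const).inv₀ hne).pow k
  · rintro z ⟨hz, -⟩
    have := hne z (Metric.ball_subset_closedBall hz)
    fun_prop (disch := assumption)

variable {E : Type*} [NormedAddCommGroup E] [InnerProductSpace ℂ E] [CompleteSpace E]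
  {V : ℕ → Submodule ℂ E} [∀ m, FiniteDimensional ℂ (V m)]
  {T : E →ₗ.[ℂ] E} {S : ∀ m, Module.End ℂ (V m)}
  {N : ∀ m, Module.End ℂ (V m)} {q : ℝ}

/-- The Neumann series of (N_m - b)⁻¹ with b = z - (m + 1) stops at N_m^k = 0, which exhibits the
resolvent on `V m` as a polynomial in b⁻¹. -/
theorem IsBlockSum.resolvent_coe (hT : IsBlockSum T S)
    (hV : IsHilbertSum ℂ (fun m => V m) fun m => (V m).subtypeₗᵢ)
    (hS : ∀ m v, S m v = ((m : ℂ) + 1) • v + N m v) {m k : ℕ} (hk : N m ^ k = 0) {z : ℂ}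
    (hz : z ∈ resolventSet T) (hzm : z - ((m : ℂ) + 1) ≠ 0) (v : V m) :
    resolvent T z v =
      -∑ j ∈ Finset.range k, ((z - ((m : ℂ) + 1))⁻¹ ^ (j + 1)) • (((N m ^ j) v : V m) : E) := by
  set b := z - ((m : ℂ) + 1)
  -- Telescoping identity with remainder b⁻ᵏ Nᵏ v, proved for every k; the remainder vanishes only
  -- at the nilpotency exponent.
  have key : ∀ k : ℕ, S m (-∑ j ∈ Finset.range k, (b⁻¹ ^ (j + 1)) • (N m ^ j) v) -
      z • (-∑ j ∈ Finset.range k, (b⁻¹ ^ (j + 1)) • (N m ^ j) v) = v - b⁻¹ ^ k • (N m ^ k) v := by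
    intro k
    rw [hS]
    induction k with
    | zero => simp
    | succ k ih =>
      rw [Finset.sum_range_succ]
      set s := ∑ j ∈ Finset.range k, (b⁻¹ ^ (j + 1)) • (N m ^ j) v
      have e1 : N m (-(s + b⁻¹ ^ (k + 1) • (N m ^ k) v)) =
          N m (-s) - b⁻¹ ^ (k + 1) • (N m ^ (k + 1)) v := by
        rw [pow_succ' (N m), Module.End.mul_apply, neg_add, map_add, map_neg (N m) (_ • _),
          map_smul]
        abel
      have e2 : b⁻¹ ^ k = b * b⁻¹ ^ (k + 1) := by
        rw [pow_succ]
        field_simp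
      rw [e1]
      have e3 : v = ((m : ℂ) + 1) • -s + N m (-s) - z • -s + b⁻¹ ^ k • (N m ^ k) v := by
        rw [ih]
        abel
      nth_rewrite 4 [e3]
      rw [e2]
      simp only [b]
      module
  have h := hT.proj_resolvent hV (isResolventAt_resolvent hz) (n := m)
    (w := -∑ j ∈ Finset.range k, (b⁻¹ ^ (j + 1)) • (N m ^ j) v) (v := v) (by
      rw [key, hk]
      simp)
  rw [h]
  simp

/-- Integrating the finite Neumann sum term by term leaves the residue of the simple pole (j = 0)
when the block's eigenvalue is the centre, and nothing when it lies outside the disc. -/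
theorem IsBlockSum.rieszProjection_coe (hT : IsBlockSum T S)
    (hV : IsHilbertSum ℂ (fun m => V m) fun m => (V m).subtypeₗᵢ)
    (hS : ∀ m v, S m v = ((m : ℂ) + 1) • v + N m v) (hN : ∀ m, IsNilpotent (N m))
    (hspec : spec T = Set.range fun m : ℕ => (m : ℂ) + 1)
    {m : ℕ} {r : ℝ} (hr : IsIsolatingRadius T ((m : ℂ) + 1) r) (n : ℕ) (v : V n) :
    rieszProjection T ((m : ℂ) + 1) r v = if n = m then (v : E) else 0 := by
  obtain ⟨hr0, hr⟩ := hr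
  have hsph : Metric.sphere ((m : ℂ) + 1) r ⊆ resolventSet T := by
    intro z hz
    by_contra h
    have h1 : z ∈ ({(m : ℂ) + 1} : Set ℂ) := hr ⟨Metric.sphere_subset_closedBall hz, h⟩
    rw [Set.mem_singleton_iff.1 h1, Metric.mem_sphere, dist_self] at hz
    exact hr0.ne hz
  have hball : n ≠ m → (n : ℂ) + 1 ∉ Metric.closedBall ((m : ℂ) + 1) r := by
    intro hnm h
    have : (n : ℂ) + 1 ∈ ({(m : ℂ) + 1} : Set ℂ) := hr ⟨h, by rw [hspec]; exact ⟨n, rfl⟩⟩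
    exact hnm (by simpa using this)
  have hne : ∀ z ∈ Metric.sphere ((m : ℂ) + 1) r, z - ((n : ℂ) + 1) ≠ 0 := by
    intro z hz h
    have h1 : z ∈ spec T := by
      rw [hspec]
      exact ⟨n, (sub_eq_zero.1 h).symm⟩
    exact h1 (hsph hz)
  obtain ⟨k, hk⟩ := hN n
  have hci : CircleIntegrable (resolvent T) ((m : ℂ) + 1) r :=
    (continuousOn_resolvent.mono hsph).circleIntegrable hr0.le
  have h1 : (∮ z in C((m : ℂ) + 1, r), resolvent T z) v =
      ∮ z in C((m : ℂ) + 1, r), resolvent T z v := by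
    rw [circleIntegral, ContinuousLinearMap.intervalIntegral_apply hci.out]
    rfl
  have h2 : (∮ z in C((m : ℂ) + 1, r), resolvent T z v) =
      -∑ j ∈ Finset.range k, (∮ z in C((m : ℂ) + 1, r), (z - ((n : ℂ) + 1))⁻¹ ^ (j + 1)) •
        (((N n ^ j) v : V n) : E) := by
    rw [circleIntegral.integral_congr hr0.le fun z hz =>
      hT.resolvent_coe hV hS hk (hsph hz) (hne z hz) v]
    simp_rw [← Finset.sum_neg_distrib, ← smul_neg]
    rw [circleIntegral.integral_fun_sum]
    · simp_rw [circleIntegral.integral_smul_const]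
    · intro j _
      refine ContinuousOn.circleIntegrable hr0.le ?_
      exact (((continuousOn_id.sub continuousOn_const).inv₀ hne).pow _).smul continuousOn_const
  rw [rieszProjection, smul_apply, h1, h2]
  split_ifs with hnm
  · subst hnm
    simp_rw [circleIntegral_inv_pow_succ_self _ hr0]
    cases k with
    -- Exponent 0 means that the identity of `V n` is zero, so the block is trivial.
    | zero =>
      have : v = 0 := by
        rw [← Module.End.one_apply (R := ℂ) v, ← pow_zero (N n), hk, LinearMap.zero_apply]
      simp [this]
    | succ k =>
      rw [Finset.sum_eq_single 0 (by intro j _ hj; simp [hj]) (by simp)]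
      simp only [if_true, pow_zero, Module.End.one_apply, neg_smul_neg, smul_smul]
      rw [inv_mul_cancel₀ Complex.two_pi_I_ne_zero, one_smul]
  · simp_rw [circleIntegral_inv_pow_of_notMem hr0 (hball hnm)]
    simp

/-- By continuity the values on the blocks determine the Riesz projection: it is the orthogonal
projection onto `V m`, even though `T` need not be normal. -/
theorem IsBlockSum.range_rieszProjection (hT : IsBlockSum T S)
    (hV : IsHilbertSum ℂ (fun m => V m) fun m => (V m).subtypeₗᵢ)
    (hS : ∀ m v, S m v = ((m : ℂ) + 1) • v + N m v) (hN : ∀ m, IsNilpotent (N m))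
    (hspec : spec T = Set.range fun m : ℕ => (m : ℂ) + 1)
    {m : ℕ} {r : ℝ} (hr : IsIsolatingRadius T ((m : ℂ) + 1) r) :
    LinearMap.range (rieszProjection T ((m : ℂ) + 1) r).toLinearMap = V m := by
  have h := hT.rieszProjection_coe hV hS hN hspec hr
  have h2 : ∀ u : E, rieszProjection T ((m : ℂ) + 1) r u = (V m).orthogonalProjectionOnto u := by
    intro u
    have h3 := (hasSum_proj hV u).mapL (rieszProjection T ((m : ℂ) + 1) r)
    refine h3.unique ?_
    simp_rw [h]
    have := hasSum_ite_eq m ((V m).orthogonalProjectionOnto u : E)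
    convert this using 2 with n
    split_ifs with hnm
    · rw [hnm]
    · rfl
  ext u
  constructor
  · rintro ⟨w, rfl⟩
    change rieszProjection T ((m : ℂ) + 1) r w ∈ V m
    rw [h2]
    exact Subtype.coe_prop _
  · intro hu
    refine ⟨u, ?_⟩
    change rieszProjection T ((m : ℂ) + 1) r u = u
    rw [h2]
    exact congrArg Subtype.val (Submodule.orthogonalProjectionOnto_mem_subspace_eq_self ⟨u, hu⟩)

theorem exists_isIsolatingRadius (hspec : spec T = Set.range fun m : ℕ => (m : ℂ) + 1) (m : ℕ) :
    ∃ r, IsIsolatingRadius T ((m : ℂ) + 1) r := by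
  refine ⟨1 / 2, by norm_num, ?_⟩
  rintro z ⟨hz, hz2⟩
  rw [hspec] at hz2
  obtain ⟨n, rfl⟩ := hz2
  rw [Metric.mem_closedBall, dist_eq_norm] at hz
  have h1 : (n : ℂ) + 1 - (m + 1) = (((n : ℤ) - m : ℤ) : ℂ) := by
    push_cast
    ring
  simp only [h1, Complex.norm_intCast] at hz
  have h2 : |((n : ℤ) - m : ℤ)| < 1 := by
    have : (|((n : ℤ) - m : ℤ)| : ℝ) < 1 := by
      push_cast at hz ⊢
      linarith
    exact_mod_cast this
  rw [Int.abs_lt_one_iff] at h2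
  have : n = m := by omega
  simp [this]

theorem IsBlockSum.hasAlgebraicMultiplicity (hT : IsBlockSum T S)
    (hV : IsHilbertSum ℂ (fun m => V m) fun m => (V m).subtypeₗᵢ)
    (hS : ∀ m v, S m v = ((m : ℂ) + 1) • v + N m v) (hN : ∀ m, IsNilpotent (N m))
    (hspec : spec T = Set.range fun m : ℕ => (m : ℂ) + 1) (m : ℕ) :
    HasAlgebraicMultiplicity T ((m : ℂ) + 1) (Module.finrank ℂ (V m)) := by
  refine ⟨exists_isIsolatingRadius hspec m, fun r hr => ?_⟩
  rw [hT.range_rieszProjection hV hS hN hspec hr, Module.finrank_eq_rank]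

end Riesz

/-! ### The Gaussian as a Schwartz function -/

section Gaussian

/-- Bound the power by p! exp(1 + t), then complete the square: t - b t² ≤ 1/(4b). -/
theorem one_add_pow_mul_exp_le {b : ℝ} (hb : 0 < b) (p : ℕ) {t : ℝ} (ht : 0 ≤ t) :
    (1 + t) ^ p * Real.exp (-b * t ^ 2) ≤ p.factorial * Real.exp (1 + 1 / (4 * b)) := by
  have h1 : (1 + t) ^ p ≤ p.factorial * Real.exp (1 + t) := by
    have := Real.pow_div_factorial_le_exp (1 + t) (by linarith) p
    rwa [div_le_iff₀' (by positivity)] at this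
  calc (1 + t) ^ p * Real.exp (-b * t ^ 2)
      ≤ p.factorial * Real.exp (1 + t) * Real.exp (-b * t ^ 2) := by gcongr
    _ = p.factorial * Real.exp (1 + t + -b * t ^ 2) := by rw [mul_assoc, ← Real.exp_add]
    _ ≤ _ := by
      refine mul_le_mul_of_nonneg_left (Real.exp_le_exp.2 ?_) (by positivity)
      have : 0 ≤ b * (t - 1 / (2 * b)) ^ 2 := by positivity
      have e : b * (t - 1 / (2 * b)) ^ 2 = b * t ^ 2 - t + 1 / (4 * b) := by
        field_simp
        ring
      linarith

variable {F : Type*} [NormedAddCommGroup F] [InnerProductSpace ℝ F]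

theorem hasTemperateGrowth_neg_mul_norm_sq (b : ℝ) :
    (fun x : F => -b * ‖x‖ ^ 2).HasTemperateGrowth :=
  (Function.HasTemperateGrowth.const (-b)).mul (Function.hasTemperateGrowth_norm_sq F)

theorem gaussian_decay {b : ℝ} (hb : 0 < b) (k n : ℕ) : ∃ C : ℝ, ∀ x : F,
    ‖x‖ ^ k * ‖iteratedFDeriv ℝ n (fun x : F => Real.exp (-b * ‖x‖ ^ 2)) x‖ ≤ C := by
  obtain ⟨l, C, hC, h⟩ := (hasTemperateGrowth_neg_mul_norm_sq (F := F) b).norm_iteratedFDeriv_le_uniform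
    n
  -- The Faà di Bruno bound n! · exp(-b‖x‖²) · Dⁿ with D = (1 + C)(1 + ‖x‖)^l leaves a factor (1 +
  -- ‖x‖)^(k + l n) to be absorbed by the Gaussian.
  refine ⟨n.factorial * (1 + C) ^ n *
    ((k + l * n).factorial * Real.exp (1 + 1 / (4 * b))), fun x => ?_⟩
  have h1 := norm_iteratedFDeriv_comp_le (n := n) (N := n) (g := Real.exp)
    (f := fun x : F => -b * ‖x‖ ^ 2) (C := Real.exp (-b * ‖x‖ ^ 2))
    (D := (1 + C) * (1 + ‖x‖) ^ l) Real.contDiff_exp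
    (contDiff_const.mul (contDiff_norm_sq ℝ)) le_rfl x
    (by
      intro i _
      rw [norm_iteratedFDeriv_eq_norm_iteratedDeriv, iteratedDeriv_eq_iterate]
      simp)
    (by
      intro i hi hin
      refine (h i hin x).trans ?_
      have h1x : (1 : ℝ) ≤ (1 + ‖x‖) ^ l := one_le_pow₀ (by linarith [norm_nonneg x])
      calc C * (1 + ‖x‖) ^ l ≤ (1 + C) * (1 + ‖x‖) ^ l := by gcongr; linarith
        -- Here D ≥ 1 and i ≥ 1, so D ≤ Dⁱ; this is why C was enlarged to 1 + C.
        _ ≤ _ := le_self_pow₀ (by nlinarith) (by omega))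
  have h2 := one_add_pow_mul_exp_le hb (k + l * n) (norm_nonneg x)
  change ‖iteratedFDeriv ℝ n (fun x : F => Real.exp (-b * ‖x‖ ^ 2)) x‖ ≤ _ at h1
  calc ‖x‖ ^ k * ‖iteratedFDeriv ℝ n (fun x : F => Real.exp (-b * ‖x‖ ^ 2)) x‖
      ≤ (1 + ‖x‖) ^ k * (n.factorial * Real.exp (-b * ‖x‖ ^ 2) * ((1 + C) * (1 + ‖x‖) ^ l) ^ n) := by
        gcongr
        linarith
    _ = n.factorial * (1 + C) ^ n * ((1 + ‖x‖) ^ (k + l * n) * Real.exp (-b * ‖x‖ ^ 2)) := by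
        rw [mul_pow, pow_add, pow_mul]
        ring
    _ ≤ _ := by gcongr

/-- The Gaussian `exp (-b ‖x‖²)`, `b > 0`, as a real Schwartz function. -/
def realGaussian {b : ℝ} (hb : 0 < b) : 𝓢(F, ℝ) where
  toFun x := Real.exp (-b * ‖x‖ ^ 2)
  smooth' := Real.contDiff_exp.comp (contDiff_const.mul (contDiff_norm_sq ℝ))
  decay' k n := gaussian_decay hb k n

/-- The Gaussian `exp (-b ‖x‖²)`, `b > 0`, as a complex Schwartz function. -/
def gaussian {b : ℝ} (hb : 0 < b) : 𝓢(F, ℂ) :=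
  (realGaussian hb).postcompCLM (𝕜 := ℝ) Complex.ofRealCLM

theorem gaussian_apply {b : ℝ} (hb : 0 < b) (x : F) :
    gaussian hb x = ((Real.exp (-b * ‖x‖ ^ 2) : ℝ) : ℂ) := rfl

end Gaussian

/-! ### One-dimensional Hermite functions -/

section Hermite

open Polynomial in
theorem derivative_hermite_succ (n : ℕ) :
    derivative (hermite (n + 1)) = ((n : ℤ[X]) + 1) * hermite n := by
  induction n with
  | zero => simp
  | succ n ih =>
    rw [hermite_succ, derivative_sub, derivative_mul, ih, derivative_X, one_mul]
    have : derivative (((n : ℤ[X]) + 1) * hermite n) =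
        ((n : ℤ[X]) + 1) * derivative (hermite n) := by
      rw [derivative_mul]
      simp
    rw [this]
    push_cast
    rw [hermite_succ n]
    ring

theorem derivative_hermite (n : ℕ) :
    Polynomial.derivative (Polynomial.hermite n) = (n : Polynomial ℤ) * Polynomial.hermite (n - 1) := by
  cases n with
  | zero => simp
  | succ n => simpa using derivative_hermite_succ n

theorem hermiteFun_norm_succ (n : ℕ) :
    (Real.sqrt (Real.sqrt Real.pi * (n.factorial : ℝ)))⁻¹ = Real.sqrt (n + 1) *
      (Real.sqrt (Real.sqrt Real.pi * ((n + 1).factorial : ℝ)))⁻¹ := by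
  have h : Real.sqrt Real.pi * ((n + 1).factorial : ℝ) =
      (n + 1) * (Real.sqrt Real.pi * (n.factorial : ℝ)) := by
    rw [Nat.factorial_succ]
    push_cast
    ring
  rw [h, Real.sqrt_mul (show (0 : ℝ) ≤ (n : ℝ) + 1 by positivity)]
  have h1 : Real.sqrt ((n : ℝ) + 1) ≠ 0 := by positivity
  rw [mul_inv, mul_inv_cancel_left₀ h1]

/-- Comes from He_n' = n He_{n-1} and the product rule. At n = 0 the truncated index n - 1 is
harmless because the factor √n vanishes; the same convention serves all ladder formulas. -/
theorem hasDerivAt_hermiteFun (n : ℕ) (x : ℝ) :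
    HasDerivAt (hermiteFun n)
      (Real.sqrt 2 * Real.sqrt n * hermiteFun (n - 1) x - x * hermiteFun n x) x := by
  have h1 : HasDerivAt (fun x : ℝ => Polynomial.aeval (Real.sqrt 2 * x) (Polynomial.hermite n))
      (Polynomial.aeval (Real.sqrt 2 * x) (Polynomial.derivative (Polynomial.hermite n)) *
        Real.sqrt 2) x :=
    HasDerivAt.comp x ((Polynomial.hermite n).hasDerivAt_aeval (Real.sqrt 2 * x))
      (by simpa using (hasDerivAt_id x).const_mul (Real.sqrt 2))
  have h2 : HasDerivAt (fun x : ℝ => Real.exp (-x ^ 2 / 2)) (Real.exp (-x ^ 2 / 2) * (-x)) x := by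
    have : HasDerivAt (fun x : ℝ => -x ^ 2 / 2) (-x) x := by
      refine (((hasDerivAt_pow 2 x).neg).div_const 2).congr_deriv ?_
      push_cast
      ring
    exact this.exp
  refine ((h1.const_mul _).mul h2).congr_deriv ?_
  rw [derivative_hermite]
  cases n with
  | zero => simp [hermiteFun]; ring
  | succ n =>
    simp only [hermiteFun, Nat.add_sub_cancel]
    rw [hermiteFun_norm_succ n]
    have h3 : Real.sqrt ((n : ℝ) + 1) * Real.sqrt ((n : ℝ) + 1) = n + 1 :=
      Real.mul_self_sqrt (by positivity)
    push_cast
    simp only [map_mul, map_add, map_natCast, map_one]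
    linear_combination (-(Real.sqrt (Real.sqrt Real.pi * ((n + 1).factorial : ℝ)))⁻¹ *
      Polynomial.aeval (Real.sqrt 2 * x) (Polynomial.hermite n) * Real.exp (-x ^ 2 / 2) *
      Real.sqrt 2) * h3

/-- The three-term recurrence He_{n+1} = X He_n - n He_{n-1} in normalized form. -/
theorem mul_hermiteFun (n : ℕ) (x : ℝ) :
    2 * x * hermiteFun n x = Real.sqrt 2 * Real.sqrt n * hermiteFun (n - 1) x +
      Real.sqrt 2 * Real.sqrt (n + 1) * hermiteFun (n + 1) x := by
  have h2 : Real.sqrt 2 * Real.sqrt 2 = 2 := Real.mul_self_sqrt (by norm_num)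
  have e : Real.sqrt 2 * Real.sqrt (n + 1) * hermiteFun (n + 1) x =
      (Real.sqrt (Real.sqrt Real.pi * (n.factorial : ℝ)))⁻¹ * Real.sqrt 2 *
        Polynomial.aeval (Real.sqrt 2 * x) (Polynomial.hermite (n + 1)) *
        Real.exp (-x ^ 2 / 2) := by
    rw [hermiteFun_norm_succ n, hermiteFun]
    ring
  rw [e, Polynomial.hermite_succ, derivative_hermite]
  cases n with
  | zero =>
    simp [hermiteFun]
    linear_combination (-x * (Real.sqrt (Real.sqrt Real.pi))⁻¹ * Real.exp (-x ^ 2 / 2)) * h2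
  | succ n =>
    simp only [hermiteFun, Nat.add_sub_cancel]
    rw [hermiteFun_norm_succ n]
    have h3 : Real.sqrt ((n : ℝ) + 1) * Real.sqrt ((n : ℝ) + 1) = n + 1 :=
      Real.mul_self_sqrt (by positivity)
    push_cast
    simp only [map_mul, map_add, map_natCast, map_one, map_sub, Polynomial.aeval_X]
    linear_combination (-x * (Real.sqrt (Real.sqrt Real.pi * ((n + 1).factorial : ℝ)))⁻¹ *
      Polynomial.aeval (Real.sqrt 2 * x) (Polynomial.hermite (n + 1)) * Real.exp (-x ^ 2 / 2)) * h2
      - ((Real.sqrt (Real.sqrt Real.pi * ((n + 1).factorial : ℝ)))⁻¹ *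
      Polynomial.aeval (Real.sqrt 2 * x) (Polynomial.hermite n) * Real.exp (-x ^ 2 / 2) *
      Real.sqrt 2) * h3

end Hermite

/-! ### Hermite functions of two variables as Schwartz functions -/

section Ladder

theorem hasTemperateGrowth_coord (i : Fin 2) :
    (fun x : Plane => x i).HasTemperateGrowth :=
  (EuclideanSpace.proj i : Plane →L[ℝ] ℝ).hasTemperateGrowth

theorem hasTemperateGrowth_coord_complex (i : Fin 2) :
    (fun x : Plane => ((x i : ℝ) : ℂ)).HasTemperateGrowth :=
  Function.Complex.hasTemperateGrowth_ofReal.comp (hasTemperateGrowth_coord i)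

theorem hasTemperateGrowth_aeval {F : Type*} [NormedAddCommGroup F] [NormedSpace ℝ F]
    {f : F → ℝ} (hf : f.HasTemperateGrowth) (P : Polynomial ℤ) :
    (fun x => Polynomial.aeval (f x) P).HasTemperateGrowth := by
  induction P using Polynomial.induction_on' with
  | add p q hp hq =>
    simp only [map_add]
    exact hp.add hq
  | monomial n a =>
    simp only [Polynomial.aeval_monomial]
    exact (Function.HasTemperateGrowth.const _).mul (hf.pow n)

/-- The polynomial factor of a product of Hermite functions. -/
def hermitePoly (p : Fin 2 → ℕ) (x : Plane) : ℝ :=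
  ((Real.sqrt (Real.sqrt Real.pi * ((p 0).factorial : ℝ)))⁻¹ *
    Polynomial.aeval (Real.sqrt 2 * x 0) (Polynomial.hermite (p 0))) *
  ((Real.sqrt (Real.sqrt Real.pi * ((p 1).factorial : ℝ)))⁻¹ *
    Polynomial.aeval (Real.sqrt 2 * x 1) (Polynomial.hermite (p 1)))

theorem hasTemperateGrowth_hermitePoly (p : Fin 2 → ℕ) :
    (fun x => ((hermitePoly p x : ℝ) : ℂ)).HasTemperateGrowth := by
  have h : ∀ (i : Fin 2) (P : Polynomial ℤ),
      (fun x : Plane => Polynomial.aeval (Real.sqrt 2 * x i) P).HasTemperateGrowth := fun i P =>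
    hasTemperateGrowth_aeval
      ((Function.HasTemperateGrowth.const _).mul (hasTemperateGrowth_coord i)) P
  exact Function.Complex.hasTemperateGrowth_ofReal.comp
    (((Function.HasTemperateGrowth.const _).mul (h 0 _)).mul
      ((Function.HasTemperateGrowth.const _).mul (h 1 _)))

/-- The product of two Hermite functions as a Schwartz function. -/
def hermiteS (p : Fin 2 → ℕ) : 𝓢(Plane, ℂ) :=
  SchwartzMap.smulLeftCLM ℂ (fun x => ((hermitePoly p x : ℝ) : ℂ))
    (gaussian (show (0 : ℝ) < 1 / 2 by norm_num))

theorem hermiteS_eq (p : Fin 2 → ℕ) (x : Plane) :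
    hermiteS p x = ((hermitePoly p x * Real.exp (-(1 / 2) * ‖x‖ ^ 2) : ℝ) : ℂ) := by
  rw [hermiteS, SchwartzMap.smulLeftCLM_apply_apply (hasTemperateGrowth_hermitePoly p),
    gaussian_apply, smul_eq_mul, ← Complex.ofReal_mul]

theorem hermiteS_apply (p : Fin 2 → ℕ) (x : Plane) :
    hermiteS p x = hermiteProd (p 0) (p 1) x := by
  rw [hermiteS_eq, hermiteProd, Complex.ofReal_inj, hermitePoly, hermiteFun, hermiteFun,
    EuclideanSpace.norm_sq_eq, Fin.sum_univ_two]
  have : Real.exp (-(1 / 2) * (‖x 0‖ ^ 2 + ‖x 1‖ ^ 2)) =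
      Real.exp (-x 0 ^ 2 / 2) * Real.exp (-x 1 ^ 2 / 2) := by
    rw [← Real.exp_add, Real.norm_eq_abs, Real.norm_eq_abs, sq_abs, sq_abs]
    congr 1
    ring
  rw [this]
  ring

/-- Multiplication by a coordinate on Schwartz functions. -/
def mulXS (i : Fin 2) : 𝓢(Plane, ℂ) →L[ℂ] 𝓢(Plane, ℂ) :=
  SchwartzMap.smulLeftCLM ℂ fun x : Plane => ((x i : ℝ) : ℂ)

theorem mulXS_apply (i : Fin 2) (f : 𝓢(Plane, ℂ)) (x : Plane) : mulXS i f x = x i * f x := by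
  rw [mulXS, SchwartzMap.smulLeftCLM_apply_apply (hasTemperateGrowth_coord_complex i), smul_eq_mul]

/-- The partial derivative on Schwartz functions. -/
def partialXS (i : Fin 2) : 𝓢(Plane, ℂ) →L[ℂ] 𝓢(Plane, ℂ) :=
  LineDeriv.lineDerivOpCLM ℂ 𝓢(Plane, ℂ) (EuclideanSpace.single i (1 : ℝ))

/-- The sign of `∂_i` in the creation (`true`) and annihilation (`false`) operators. -/
def ladderSign (b : Bool) : ℂ := if b then -1 else 1

/-- Creation (`true`) and annihilation (`false`) operators on distributions. -/
def ladder (i : Fin 2) (b : Bool) : 𝓢'(Plane, ℂ) →ₗ[ℂ] 𝓢'(Plane, ℂ) :=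
  ((Real.sqrt 2 : ℝ) : ℂ)⁻¹ • (mulX i + ladderSign b • partialX i)

/-- Creation (`true`) and annihilation (`false`) operators on Schwartz functions. -/
def ladderS (i : Fin 2) (b : Bool) : 𝓢(Plane, ℂ) →L[ℂ] 𝓢(Plane, ℂ) :=
  ((Real.sqrt 2 : ℝ) : ℂ)⁻¹ • (mulXS i + ladderSign b • partialXS i)

theorem ladder_false (i : Fin 2) : ladder i false = ann i := by simp [ladder, ladderSign, ann]

theorem ladder_true (i : Fin 2) : ladder i true = cre i := by
  simp [ladder, ladderSign, cre, sub_eq_add_neg]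

theorem ladderSign_not (b : Bool) : ladderSign (!b) = -ladderSign b := by
  cases b <;> simp [ladderSign]

theorem mulX_apply (i : Fin 2) (U : 𝓢'(Plane, ℂ)) (f : 𝓢(Plane, ℂ)) :
    mulX i U f = U (mulXS i f) := rfl

theorem partialX_apply (i : Fin 2) (U : 𝓢'(Plane, ℂ)) (f : 𝓢(Plane, ℂ)) :
    partialX i U f = -U (partialXS i f) := by
  rw [← map_neg]
  rfl

/-- Integration by parts: for the bilinear pairing, creation and annihilation in the same variable
are transposes of each other. -/
theorem ladder_apply (i : Fin 2) (b : Bool) (U : 𝓢'(Plane, ℂ)) (f : 𝓢(Plane, ℂ)) :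
    ladder i b U f = U (ladderS i (!b) f) := by
  change ((Real.sqrt 2 : ℝ) : ℂ)⁻¹ • (mulX i U f + ladderSign b • partialX i U f) =
    U (((Real.sqrt 2 : ℝ) : ℂ)⁻¹ • (mulXS i f + ladderSign (!b) • partialXS i f))
  rw [mulX_apply, partialX_apply, ladderSign_not, map_smul, map_add, map_smul, neg_smul, smul_neg]

/-- The multi-index reached from `p` by creation or annihilation in the variable `i`. -/
def ladderIndex (i : Fin 2) (b : Bool) (p : Fin 2 → ℕ) : Fin 2 → ℕ :=
  Function.update p i (if b then p i + 1 else p i - 1)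

/-- The coefficient with which a ladder operator maps one Hermite function to another. -/
def ladderWeight (i : Fin 2) (b : Bool) (p : Fin 2 → ℕ) : ℝ :=
  Real.sqrt (if b then p i + 1 else p i)

theorem partialXS_hermiteS (i : Fin 2) (p : Fin 2 → ℕ) :
    partialXS i (hermiteS p) = (Real.sqrt 2 * Real.sqrt (p i) : ℝ) •
      hermiteS (ladderIndex i false p) - mulXS i (hermiteS p) := by
  ext x
  change _ = (Real.sqrt 2 * Real.sqrt (p i) : ℝ) • hermiteS (ladderIndex i false p) x -
    mulXS i (hermiteS p) x
  rw [mulXS_apply, partialXS, LineDeriv.lineDerivOpCLM_apply, SchwartzMap.lineDerivOp_apply]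
  refine HasLineDerivAt.lineDeriv ?_
  rw [HasLineDerivAt]
  have hd : ∀ n : ℕ, HasDerivAt (fun t : ℝ => hermiteFun n (x i + t))
      (Real.sqrt 2 * Real.sqrt n * hermiteFun (n - 1) (x i) - x i * hermiteFun n (x i)) 0 := by
    intro n
    refine HasDerivAt.comp_const_add (x i) 0 ?_
    rw [add_zero]
    exact hasDerivAt_hermiteFun n (x i)
  simp only [hermiteS_apply, hermiteProd]
  fin_cases i
  · have := ((hd (p 0)).mul_const (hermiteFun (p 1) (x 1))).ofReal_comp
    refine (this.congr_deriv ?_).congr_of_eventuallyEq (Filter.Eventually.of_forall fun t => ?_)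
    · simp [ladderIndex]
      ring
    · simp
  · have := ((hd (p 1)).const_mul (hermiteFun (p 0) (x 0))).ofReal_comp
    refine (this.congr_deriv ?_).congr_of_eventuallyEq (Filter.Eventually.of_forall fun t => ?_)
    · simp [ladderIndex]
      ring
    · simp

theorem two_mulXS_hermiteS (i : Fin 2) (p : Fin 2 → ℕ) :
    (2 : ℝ) • mulXS i (hermiteS p) = (Real.sqrt 2 * Real.sqrt (p i) : ℝ) •
      hermiteS (ladderIndex i false p) + (Real.sqrt 2 * Real.sqrt (p i + 1) : ℝ) •
      hermiteS (ladderIndex i true p) := by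
  ext x
  change (2 : ℝ) • mulXS i (hermiteS p) x = (Real.sqrt 2 * Real.sqrt (p i) : ℝ) •
    hermiteS (ladderIndex i false p) x + (Real.sqrt 2 * Real.sqrt (p i + 1) : ℝ) •
      hermiteS (ladderIndex i true p) x
  rw [mulXS_apply]
  simp only [hermiteS_apply, hermiteProd, Complex.real_smul]
  have h := mul_hermiteFun (p i) (x i)
  norm_cast
  fin_cases i
  · simp [ladderIndex] at h ⊢
    linear_combination (hermiteFun (p 1) (x 1)) * h
  · simp [ladderIndex] at h ⊢
    linear_combination (hermiteFun (p 0) (x 0)) * h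

theorem ladderS_hermiteS (i : Fin 2) (b : Bool) (p : Fin 2 → ℕ) :
    ladderS i b (hermiteS p) = ((ladderWeight i b p : ℝ) : ℂ) • hermiteS (ladderIndex i b p) := by
  have h1 := partialXS_hermiteS i p
  have h2 := two_mulXS_hermiteS i p
  have h3 : (Real.sqrt 2 : ℝ) ≠ 0 := by positivity
  change ((Real.sqrt 2 : ℝ) : ℂ)⁻¹ • (mulXS i (hermiteS p) +
    ladderSign b • partialXS i (hermiteS p)) = _
  rw [← Complex.ofReal_inv, Complex.coe_smul, Complex.coe_smul]
  rw [inv_smul_eq_iff₀ h3, smul_smul]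
  cases b
  · simp only [ladderSign, Bool.false_eq_true, if_false, one_smul, h1, ladderWeight]
    abel
  · simp only [ladderSign, if_true, h1, ladderWeight, neg_smul, one_smul]
    -- Since ∂ψ is the lowered term minus xψ, (x - ∂)ψ equals 2xψ minus the lowered term, which by
    -- the recurrence is the raised term.
    rw [← sub_eq_iff_eq_add'.2 h2]
    module

end Ladder

/-! ### Orthonormality of the Hermite functions -/

section Orthonormal

/-- The product of two Hermite functions as a vector of `L²`. -/
def hermiteL2 (p : Fin 2 → ℕ) : L2 := (memLp_hermiteProd (p 0) (p 1)).toLp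

theorem hermiteL2_eq_toLp (p : Fin 2 → ℕ) : hermiteL2 p = (hermiteS p).toLp 2 := by
  unfold hermiteL2 SchwartzMap.toLp
  congr 1
  ext x
  exact (hermiteS_apply p x).symm

theorem toDist_apply (u : L2) (f : 𝓢(Plane, ℂ)) : toDist u f = ∫ x, f x * u x := by
  rw [toDist, Lp.toTemperedDistributionCLM_apply, Lp.toTemperedDistribution_apply]
  rfl

theorem toDist_toLp (f : 𝓢(Plane, ℂ)) :
    toDist (f.toLp 2) = SchwartzMap.toTemperedDistributionCLM Plane ℂ volume f := by
  rw [toDist, Lp.toTemperedDistributionCLM_apply, Lp.toTemperedDistribution_toLp_eq]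

theorem toDist_toLp_apply (f g : 𝓢(Plane, ℂ)) : toDist (f.toLp 2) g = ∫ x, g x * f x := by
  rw [toDist_apply]
  refine integral_congr_ae ?_
  filter_upwards [f.coeFn_toLp 2 volume] with x hx
  rw [hx]

/-- Hermite functions are real, so the Hermitian product agrees with the bilinear distributional
pairing; this carries the duality of ladder operators over to `L2`. -/
theorem inner_hermiteL2 (p : Fin 2 → ℕ) (u : L2) : ⟪hermiteL2 p, u⟫_ℂ = toDist u (hermiteS p) := by
  rw [toDist_apply, L2.inner_def]
  refine integral_congr_ae ?_
  filter_upwards [(memLp_hermiteProd (p 0) (p 1)).coeFn_toLp] with x hx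
  rw [hermiteL2, hx, RCLike.inner_apply, hermiteS_apply, hermiteProd, Complex.conj_ofReal, mul_comm]

theorem mulX_toDist (i : Fin 2) (f : 𝓢(Plane, ℂ)) :
    mulX i (toDist (f.toLp 2)) = toDist ((mulXS i f).toLp 2) := by
  ext g
  rw [mulX_apply, toDist_toLp_apply, toDist_toLp_apply]
  congr 1
  ext x
  rw [mulXS_apply, mulXS_apply]
  ring

theorem partialX_toDist (i : Fin 2) (f : 𝓢(Plane, ℂ)) :
    partialX i (toDist (f.toLp 2)) = toDist ((partialXS i f).toLp 2) := by
  rw [toDist_toLp, toDist_toLp]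
  exact TemperedDistribution.lineDerivOp_toTemperedDistributionCLM_eq f _

theorem ladder_toDist (i : Fin 2) (b : Bool) (f : 𝓢(Plane, ℂ)) :
    ladder i b (toDist (f.toLp 2)) = toDist ((ladderS i b f).toLp 2) := by
  have h : ∀ f : 𝓢(Plane, ℂ), f.toLp 2 = SchwartzMap.toLpCLM ℂ ℂ 2 (volume : Measure Plane) f :=
    fun f => rfl
  have h2 : ladderS i b f = ((Real.sqrt 2 : ℝ) : ℂ)⁻¹ • (mulXS i f + ladderSign b • partialXS i f) :=
    rfl
  rw [h2, h (_ • _), map_smul, map_add, map_smul, map_smul, map_add, map_smul, ← h, ← h,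
    ← mulX_toDist, ← partialX_toDist]
  rfl

theorem ladder_hermiteL2 (i : Fin 2) (b : Bool) (p : Fin 2 → ℕ) :
    ladder i b (toDist (hermiteL2 p)) =
      ((ladderWeight i b p : ℝ) : ℂ) • toDist (hermiteL2 (ladderIndex i b p)) := by
  rw [hermiteL2_eq_toLp, ladder_toDist, ladderS_hermiteS, hermiteL2_eq_toLp]
  have h : ∀ f : 𝓢(Plane, ℂ), f.toLp 2 = SchwartzMap.toLpCLM ℂ ℂ 2 (volume : Measure Plane) f :=
    fun f => rfl
  rw [h (_ • _), map_smul, map_smul, ← h]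

theorem ladderWeight_mul_inner (i : Fin 2) (b : Bool) (p r : Fin 2 → ℕ) :
    (ladderWeight i b p : ℂ) * ⟪hermiteL2 (ladderIndex i b p), hermiteL2 r⟫_ℂ =
      (ladderWeight i (!b) r : ℂ) * ⟪hermiteL2 p, hermiteL2 (ladderIndex i (!b) r)⟫_ℂ := by
  rw [inner_hermiteL2, inner_hermiteL2]
  have h := ladder_apply i (!b) (toDist (hermiteL2 r)) (hermiteS p)
  rw [Bool.not_not, ladderS_hermiteS, ladder_hermiteL2, map_smul] at h
  exact h.symm

theorem ladderIndex_true_false (i : Fin 2) (p : Fin 2 → ℕ) :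
    ladderIndex i false (ladderIndex i true p) = p := by
  simp [ladderIndex]

theorem ladderIndex_false_true (i : Fin 2) (p : Fin 2 → ℕ) (h : p i ≠ 0) :
    ladderIndex i true (ladderIndex i false p) = p := by
  simp [ladderIndex, Nat.sub_add_cancel (Nat.pos_of_ne_zero h)]

theorem ladderWeight_true (i : Fin 2) (p : Fin 2 → ℕ) :
    ladderWeight i false (ladderIndex i true p) = ladderWeight i true p := by
  simp [ladderIndex, ladderWeight]

theorem ladderWeight_true_mul_self (i : Fin 2) (p : Fin 2 → ℕ) :
    ladderWeight i true p * ladderWeight i true p = p i + 1 :=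
  Real.mul_self_sqrt (by positivity)

theorem ladderWeight_false_mul_self (i : Fin 2) (p : Fin 2 → ℕ) :
    ladderWeight i false p * ladderWeight i false p = p i :=
  Real.mul_self_sqrt (by positivity)

/-- The number operator is symmetric on Hermite functions. -/
theorem natCast_mul_inner (i : Fin 2) (p r : Fin 2 → ℕ) :
    ((p i : ℕ) : ℂ) * ⟪hermiteL2 p, hermiteL2 r⟫_ℂ =
      ((r i : ℕ) : ℂ) * ⟪hermiteL2 p, hermiteL2 r⟫_ℂ := by
  -- This is ⟨a^* a p, r⟩ = ⟨a p, a r⟩; the right side is symmetric in p and r up to conjugation,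
  -- and the claim follows by exchanging them.
  have key : ∀ p r : Fin 2 → ℕ, ((p i : ℕ) : ℂ) * ⟪hermiteL2 p, hermiteL2 r⟫_ℂ =
      (ladderWeight i false p * ladderWeight i false r : ℝ) *
        ⟪hermiteL2 (ladderIndex i false p), hermiteL2 (ladderIndex i false r)⟫_ℂ := by
    intro p r
    by_cases h : p i = 0
    · simp [h, ladderWeight]
    · have h1 := ladderWeight_mul_inner i true (ladderIndex i false p) r
      rw [ladderIndex_false_true i p h, ← ladderWeight_true, ladderIndex_false_true i p h] at h1
      have h2 : ((p i : ℕ) : ℂ) = ((ladderWeight i false p : ℝ) : ℂ) * (ladderWeight i false p : ℝ) := by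
        rw [← Complex.ofReal_mul, ladderWeight_false_mul_self]
        simp
      rw [h2, mul_assoc, h1, Complex.ofReal_mul, mul_assoc]
      rfl
  have h1 := key r p
  rw [← inner_conj_symm, ← inner_conj_symm (hermiteL2 (ladderIndex i false r))] at h1
  have h2 := congrArg (starRingEnd ℂ) h1
  rw [map_mul, map_mul, Complex.conj_conj, Complex.conj_conj, Complex.conj_ofReal,
    Complex.conj_natCast] at h2
  rw [key, h2, mul_comm (ladderWeight i false p)]

/-- Distinct multi-indices are separated by an eigenvalue of one of the two number operators. -/
theorem inner_hermiteL2_of_ne {p r : Fin 2 → ℕ} (h : p ≠ r) :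
    ⟪hermiteL2 p, hermiteL2 r⟫_ℂ = 0 := by
  obtain ⟨i, hi⟩ := Function.ne_iff.1 h
  have := natCast_mul_inner i p r
  rw [← sub_eq_zero, ← sub_mul, mul_eq_zero, sub_eq_zero] at this
  exact this.resolve_left (by exact_mod_cast hi)

/-- The adjoint relation between p and its raised index has the same nonzero weight on both sides.
Norms thus reduce to that of the ground state, a Gaussian integral. -/
theorem inner_self_hermiteL2_ladderIndex (i : Fin 2) (p : Fin 2 → ℕ) :
    ⟪hermiteL2 (ladderIndex i true p), hermiteL2 (ladderIndex i true p)⟫_ℂ =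
      ⟪hermiteL2 p, hermiteL2 p⟫_ℂ := by
  have h := ladderWeight_mul_inner i true p (ladderIndex i true p)
  simp only [Bool.not_true] at h
  rw [ladderWeight_true, ladderIndex_true_false] at h
  refine mul_left_cancel₀ ?_ h
  intro h0
  have := ladderWeight_true_mul_self i p
  rw [Complex.ofReal_eq_zero.1 h0] at this
  have : (0 : ℝ) ≤ p i := Nat.cast_nonneg _
  linarith

theorem hermiteS_zero (x : Plane) :
    hermiteS 0 x = (((Real.sqrt Real.pi)⁻¹ * Real.exp (-(1 / 2) * ‖x‖ ^ 2) : ℝ) : ℂ) := by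
  rw [hermiteS_eq]
  congr 2
  simp only [hermitePoly, Pi.zero_apply, Nat.factorial_zero, Nat.cast_one, mul_one,
    Polynomial.hermite_zero, map_one]
  rw [← mul_inv, Real.mul_self_sqrt (Real.sqrt_nonneg _)]

theorem inner_self_hermiteL2_zero : ⟪hermiteL2 0, hermiteL2 0⟫_ℂ = 1 := by
  rw [inner_hermiteL2, hermiteL2_eq_toLp, toDist_toLp_apply]
  have h : ∀ x : Plane, hermiteS 0 x * hermiteS 0 x =
      ((Real.pi⁻¹ * Real.exp (-1 * ‖x‖ ^ 2) : ℝ) : ℂ) := by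
    intro x
    rw [hermiteS_zero, ← Complex.ofReal_mul]
    congr 1
    have e1 : (Real.sqrt Real.pi)⁻¹ * (Real.sqrt Real.pi)⁻¹ = Real.pi⁻¹ := by
      rw [← mul_inv, Real.mul_self_sqrt Real.pi_nonneg]
    have e2 : Real.exp (-(1 / 2) * ‖x‖ ^ 2) * Real.exp (-(1 / 2) * ‖x‖ ^ 2) =
        Real.exp (-1 * ‖x‖ ^ 2) := by
      rw [← Real.exp_add]
      congr 1
      ring
    rw [← e1, ← e2]
    ring
  simp_rw [h]
  rw [integral_complex_ofReal, integral_const_mul,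
    GaussianFourier.integral_rexp_neg_mul_sq_norm one_pos]
  simp [Real.pi_ne_zero]

theorem inner_self_hermiteL2 (p : Fin 2 → ℕ) : ⟪hermiteL2 p, hermiteL2 p⟫_ℂ = 1 := by
  induction hn : p 0 + p 1 generalizing p with
  | zero =>
    have : p = 0 := by
      ext i
      fin_cases i <;> simp <;> omega
    rw [this, inner_self_hermiteL2_zero]
  | succ n ih =>
    have hi : ∃ i, p i ≠ 0 := by
      by_contra! h
      rw [h, h] at hn
      omega
    obtain ⟨i, hi⟩ := hi
    rw [← ladderIndex_false_true i p hi, inner_self_hermiteL2_ladderIndex]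
    refine ih _ ?_
    fin_cases i <;> simp [ladderIndex] at hi ⊢ <;> omega

theorem orthonormal_hermiteL2 : Orthonormal ℂ hermiteL2 := by
  classical
  rw [orthonormal_iff_ite]
  intro p r
  split_ifs with h
  · rw [h, inner_self_hermiteL2]
  · exact inner_hermiteL2_of_ne h

end Orthonormal

/-! ### Completeness of the Hermite functions -/

section Complete

/-- By the recurrence the Hermite span is stable under the coordinates, so it contains every
polynomial times the ground state. -/
theorem mulXS_mem_span (i : Fin 2) {f : 𝓢(Plane, ℂ)}
    (hf : f ∈ Submodule.span ℂ (Set.range hermiteS)) :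
    mulXS i f ∈ Submodule.span ℂ (Set.range hermiteS) := by
  induction hf using Submodule.span_induction with
  | mem f hf =>
    obtain ⟨p, rfl⟩ := hf
    have h : mulXS i (hermiteS p) = (2 : ℂ)⁻¹ • ((2 : ℝ) • mulXS i (hermiteS p)) := by
      rw [← Complex.coe_smul, smul_smul]
      simp
    rw [h, two_mulXS_hermiteS]
    refine Submodule.smul_mem _ _ (Submodule.add_mem _ ?_ ?_) <;>
    · rw [← Complex.coe_smul]
      exact Submodule.smul_mem _ _ (Submodule.subset_span ⟨_, rfl⟩)
  | zero => simp
  | add f g _ _ hf hg =>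
    rw [map_add]
    exact Submodule.add_mem _ hf hg
  | smul c f _ hf =>
    rw [map_smul]
    exact Submodule.smul_mem _ _ hf

theorem exists_inner_pow_mul_mem_span (w : Plane) (n : ℕ) :
    ∃ f ∈ Submodule.span ℂ (Set.range hermiteS), ∀ x, f x = ((⟪x, w⟫_ℝ : ℝ) : ℂ) ^ n * hermiteS 0 x := by
  induction n with
  | zero => exact ⟨hermiteS 0, Submodule.subset_span ⟨0, rfl⟩, fun x => by simp⟩
  | succ n ih =>
    obtain ⟨f, hf, h⟩ := ih
    refine ⟨((w 0 : ℝ) : ℂ) • mulXS 0 f + ((w 1 : ℝ) : ℂ) • mulXS 1 f, ?_, fun x => ?_⟩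
    · exact Submodule.add_mem _ (Submodule.smul_mem _ _ (mulXS_mem_span 0 hf))
        (Submodule.smul_mem _ _ (mulXS_mem_span 1 hf))
    · change ((w 0 : ℝ) : ℂ) • mulXS 0 f x + ((w 1 : ℝ) : ℂ) • mulXS 1 f x = _
      have e : (⟪x, w⟫_ℝ : ℝ) = w 0 * x 0 + w 1 * x 1 := by
        simp [PiLp.inner_apply, Fin.sum_univ_two]
      rw [mulXS_apply, mulXS_apply, h, e, smul_eq_mul, smul_eq_mul]
      push_cast
      ring

/-- `exp (a ‖x‖)` times the Gaussian is dominated by a Gaussian. -/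
theorem exp_mul_norm_hermiteS_zero_le {a : ℝ} (x : Plane) {t : ℝ} (ht : t ≤ a * ‖x‖) :
    Real.exp t * ‖hermiteS 0 x‖ ≤
      (Real.sqrt Real.pi)⁻¹ * Real.exp (a ^ 2) * Real.exp (-(1 / 4) * ‖x‖ ^ 2) := by
  rw [hermiteS_zero, Complex.norm_real, Real.norm_of_nonneg (by positivity)]
  have h : Real.exp t * Real.exp (-(1 / 2) * ‖x‖ ^ 2) ≤
      Real.exp (a ^ 2) * Real.exp (-(1 / 4) * ‖x‖ ^ 2) := by
    rw [← Real.exp_add, ← Real.exp_add, Real.exp_le_exp]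
    nlinarith [sq_nonneg (‖x‖ / 2 - a)]
  calc _ = (Real.sqrt Real.pi)⁻¹ * (Real.exp t * Real.exp (-(1 / 2) * ‖x‖ ^ 2)) := by ring
    _ ≤ (Real.sqrt Real.pi)⁻¹ * (Real.exp (a ^ 2) * Real.exp (-(1 / 4) * ‖x‖ ^ 2)) := by gcongr
    _ = _ := by ring

/-- The wider Gaussian exp(-‖x‖²/4) absorbs the exponential and is still in L², so its product with
u is integrable. This dominates the exponential series below. -/
theorem integrable_exp_mul_hermiteS_zero_mul (u : L2) (w : Plane) (c : ℝ) :
    Integrable fun x : Plane => Real.exp |c * ⟪x, w⟫_ℝ| * ‖hermiteS 0 x * u x‖ := by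
  have h1 : Integrable fun x : Plane =>
      (gaussian (show (0 : ℝ) < 1 / 4 by norm_num) : 𝓢(Plane, ℂ)) x * u x :=
    ((gaussian _ : 𝓢(Plane, ℂ)).memLp 2).integrable_mul (Lp.memLp u)
  have hm := (Lp.memLp u).aestronglyMeasurable
  have hc : Continuous fun x : Plane => Real.exp |c * ⟪x, w⟫_ℝ| := by fun_prop
  refine (h1.norm.const_mul ((Real.sqrt Real.pi)⁻¹ * Real.exp ((|c| * ‖w‖) ^ 2))).mono'
    (hc.aestronglyMeasurable.mul ((hermiteS 0).continuous.aestronglyMeasurable.mul hm).norm)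
    (Filter.Eventually.of_forall fun x => ?_)
  rw [Real.norm_of_nonneg (by positivity), norm_mul, norm_mul, gaussian_apply, Complex.norm_real,
    Real.norm_of_nonneg (Real.exp_pos _).le, ← mul_assoc, ← mul_assoc]
  refine mul_le_mul_of_nonneg_right ?_ (norm_nonneg _)
  refine exp_mul_norm_hermiteS_zero_le x ?_
  rw [abs_mul]
  have := abs_real_inner_le_norm x w
  have := abs_nonneg c
  nlinarith

/-- Expand the Fourier kernel in its power series and integrate term by term: each term is a
multiple of the pairing of u with ⟨x, w⟩ⁿ times the ground state, which lies in the Hermite span. -/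
theorem fourier_hermiteS_zero_mul_eq_zero {u : L2} (hu : ∀ p, toDist u (hermiteS p) = 0)
    (w : Plane) : FourierTransform.fourier (fun x : Plane => hermiteS 0 x * u x) w = 0 := by
  have hspan : ∀ f ∈ Submodule.span ℂ (Set.range hermiteS), toDist u f = 0 := by
    intro f hf
    induction hf using Submodule.span_induction with
    | mem f hf =>
      obtain ⟨p, rfl⟩ := hf
      exact hu p
    | zero => exact map_zero _
    | add f g _ _ hf hg => rw [map_add, hf, hg, add_zero]
    | smul c f _ hf => rw [map_smul, hf, smul_zero]
  have hm := (Lp.memLp u).aestronglyMeasurable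
  have hmv := (hermiteS 0).continuous.aestronglyMeasurable.mul hm
  rw [Real.fourier_eq']
  set z : Plane → ℂ := fun x => ((-2 * Real.pi * ⟪x, w⟫_ℝ : ℝ) : ℂ) * Complex.I
  have hz : Continuous z := by
    have : Continuous fun x : Plane => -2 * Real.pi * ⟪x, w⟫_ℝ := by fun_prop
    exact (Complex.continuous_ofReal.comp this).mul continuous_const
  have hnz : ∀ x, ‖z x‖ = |-2 * Real.pi * ⟪x, w⟫_ℝ| := by
    intro x
    simp only [z]
    rw [norm_mul, Complex.norm_I, mul_one, Complex.norm_real, Real.norm_eq_abs]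
  have hsum : ∀ x, HasSum (fun n : ℕ => ‖z x‖ ^ n / n.factorial * ‖hermiteS 0 x * u x‖)
      (Real.exp ‖z x‖ * ‖hermiteS 0 x * u x‖) := by
    intro x
    have := NormedSpace.expSeries_div_hasSum_exp ‖z x‖
    rw [← Real.exp_eq_exp_ℝ] at this
    exact this.mul_right _
  have h := hasSum_integral_of_dominated_convergence (μ := (volume : Measure Plane))
    (F := fun (n : ℕ) x => z x ^ n / n.factorial * (hermiteS 0 x * u x))
    (f := fun x => Complex.exp (z x) • (hermiteS 0 x * u x))
    (fun n x => ‖z x‖ ^ n / n.factorial * ‖hermiteS 0 x * u x‖)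
    (fun n => ((hz.pow n).div_const _).aestronglyMeasurable.mul hmv)
    (fun n => Filter.Eventually.of_forall fun x => by simp)
    (Filter.Eventually.of_forall fun x => (hsum x).summable)
    (by
      simp_rw [fun x => (hsum x).tsum_eq, hnz]
      exact integrable_exp_mul_hermiteS_zero_mul u w (-2 * Real.pi))
    (Filter.Eventually.of_forall fun x => by
      have := NormedSpace.expSeries_div_hasSum_exp (z x)
      rw [← Complex.exp_eq_exp_ℂ] at this
      exact this.mul_right _)
  refine h.unique ?_
  convert hasSum_zero with n
  obtain ⟨f, hf, hfx⟩ := exists_inner_pow_mul_mem_span w n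
  have h0 := hspan f hf
  rw [toDist_apply] at h0
  have e : ∀ x, z x ^ n / n.factorial * (hermiteS 0 x * u x) =
      ((((-2 * Real.pi : ℝ) : ℂ) * Complex.I) ^ n / n.factorial) * (f x * u x) := by
    intro x
    rw [hfx]
    simp only [z]
    push_cast
    ring
  simp_rw [e]
  rw [integral_const_mul, h0, mul_zero]

/-- Injectivity of the Fourier transform on L¹ by duality: every Schwartz function is a Fourier
transform, which can be moved onto v. Test functions then detect v. -/
theorem ae_eq_zero_of_fourier_eq_zero {v : Plane → ℂ} (hv : Integrable v)
    (h : ∀ w, FourierTransform.fourier v w = 0) : ∀ᵐ x, v x = 0 := by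
  have h1 : ∀ f : 𝓢(Plane, ℂ), ∫ x, f x * v x = 0 := by
    intro f
    have h2 := VectorFourier.integral_fourierIntegral_smul_eq_flip (L := innerₗ Plane)
      (μ := volume) (ν := volume) (f := ⇑(FourierTransform.fourierInv f)) (g := v)
      Real.continuous_fourierChar continuous_inner (FourierTransform.fourierInv f).integrable hv
    rw [flip_innerₗ] at h2
    have h3 : ∀ ξ, VectorFourier.fourierIntegral Real.fourierChar volume (innerₗ Plane)
        (⇑(FourierTransform.fourierInv f)) ξ = f ξ := by
      intro ξ
      have h4 : FourierTransform.fourier (FourierTransform.fourierInv f) = f :=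
        FourierTransform.fourier_fourierInv_eq f
      nth_rewrite 2 [← h4]
      rw [SchwartzMap.fourier_coe]
      rfl
    have h5 : ∀ x, VectorFourier.fourierIntegral Real.fourierChar volume (innerₗ Plane) v x = 0 := h
    simp_rw [h3, h5, smul_zero, integral_zero] at h2
    exact h2
  refine ae_eq_zero_of_integral_contDiff_smul_eq_zero hv.locallyIntegrable ?_
  intro g hg hgc
  have hg₁ : HasCompactSupport (Complex.ofRealCLM ∘ g) := hgc.comp_left rfl
  have hg₂ : ContDiff ℝ ((⊤ : ℕ∞) : WithTop ℕ∞) (Complex.ofRealCLM ∘ g) :=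
    Complex.ofRealCLM.contDiff.comp hg
  rw [← h1 (hg₁.toSchwartzMap hg₂)]
  rfl

theorem eq_zero_of_toDist_hermiteS {u : L2} (hu : ∀ p, toDist u (hermiteS p) = 0) : u = 0 := by
  have hi : Integrable fun x : Plane => hermiteS 0 x * u x :=
    ((hermiteS 0).memLp 2).integrable_mul (Lp.memLp u)
  have h := ae_eq_zero_of_fourier_eq_zero hi (fourier_hermiteS_zero_mul_eq_zero hu)
  rw [Lp.eq_zero_iff_ae_eq_zero]
  filter_upwards [h] with x hx
  refine (mul_eq_zero.1 hx).resolve_left ?_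
  rw [hermiteS_zero, Complex.ofReal_eq_zero]
  have : 0 < Real.sqrt Real.pi := Real.sqrt_pos.2 Real.pi_pos
  exact ne_of_gt (by positivity)

theorem span_hermiteL2_orthogonal : (Submodule.span ℂ (Set.range hermiteL2))ᗮ = ⊥ := by
  rw [Submodule.eq_bot_iff]
  intro u hu
  refine eq_zero_of_toDist_hermiteS fun p => ?_
  rw [← inner_hermiteL2]
  exact hu _ (Submodule.subset_span ⟨p, rfl⟩)

end Complete

/-! ### The domain of the harmonic oscillator in terms of Hermite coefficients -/

section Domain

/-- The pairing of `L²` functions with a fixed Schwartz function. -/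
def toDistEval (f : 𝓢(Plane, ℂ)) : L2 →L[ℂ] ℂ :=
  (PointwiseConvergenceCLM.evalCLM (RingHom.id ℂ) ℂ f).comp toDist

/-- A formal operator with a transpose commutes with convergent sums. -/
theorem apply_toDist_of_hasSum {A : 𝓢'(Plane, ℂ) →ₗ[ℂ] 𝓢'(Plane, ℂ)}
    {B : 𝓢(Plane, ℂ) → 𝓢(Plane, ℂ)} (hA : ∀ U f, A U f = U (B f)) {ι : Type*} {v y : ι → L2}
    {u w : L2} (hv : HasSum v u) (hy : HasSum y w) (h : ∀ i, A (toDist (v i)) = toDist (y i)) :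
    A (toDist u) = toDist w := by
  ext f
  have hs : ∀ f : 𝓢(Plane, ℂ), ∀ {v : ι → L2} {u : L2}, HasSum v u →
      HasSum (fun i => toDist (v i) f) (toDist u f) := by
    intro f v u hv
    exact hv.mapL (toDistEval f)
  rw [hA]
  refine (hs (B f) hv).unique ?_
  simp_rw [← hA, h]
  exact hs f hy

/-- Applied to the lines spanned by the y_i, so that zero vectors are allowed. -/
theorem summable_of_pairwise_orthogonal {E ι : Type*} [NormedAddCommGroup E]
    [InnerProductSpace ℂ E] [CompleteSpace E] {y : ι → E}
    (h : Pairwise fun i j => ⟪y i, y j⟫_ℂ = 0) (hs : Summable fun i => ‖y i‖ ^ 2) :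
    Summable y := by
  have hO : OrthogonalFamily ℂ (fun i => Submodule.span ℂ {y i})
      fun i => (Submodule.span ℂ {y i}).subtypeₗᵢ := by
    refine OrthogonalFamily.of_pairwise fun i j hij => ?_
    change Submodule.span ℂ {y i} ⟂ Submodule.span ℂ {y j}
    rw [Submodule.isOrtho_span]
    rintro _ rfl _ rfl
    exact h hij
  have := hO.summable_iff_norm_sq_summable
    (fun i => ⟨y i, Submodule.mem_span_singleton_self _⟩)
  exact this.2 hs

/-- The Hilbert basis of `L²` formed by the Hermite functions. -/
def hermiteBasis : HilbertBasis (Fin 2 → ℕ) ℂ L2 :=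
  HilbertBasis.mkOfOrthogonalEqBot orthonormal_hermiteL2 span_hermiteL2_orthogonal

theorem hasSum_hermiteL2 (u : L2) :
    HasSum (fun p => ⟪hermiteL2 p, u⟫_ℂ • hermiteL2 p) u := by
  have := hermiteBasis.hasSum_repr u
  simp only [HilbertBasis.repr_apply_apply] at this
  simpa [hermiteBasis] using this

/-- Truncated subtraction identifies p_i = 0 with p_i = 1; a nonzero weight excludes the former. -/
theorem ladderIndex_injective_of_weight {i : Fin 2} {b : Bool} {p r : Fin 2 → ℕ}
    (hp : ladderWeight i b p ≠ 0) (hr : ladderWeight i b r ≠ 0)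
    (h : ladderIndex i b p = ladderIndex i b r) : p = r := by
  cases b
  · have h0 : ∀ p : Fin 2 → ℕ, ladderWeight i false p ≠ 0 → p i ≠ 0 := by
      intro p hp h0
      simp [ladderWeight, h0] at hp
    rw [← ladderIndex_false_true i p (h0 p hp), ← ladderIndex_false_true i r (h0 r hr), h]
  · rw [← ladderIndex_true_false i p, ← ladderIndex_true_false i r, h]

theorem ladderWeight_sq_le (i : Fin 2) (b : Bool) (p : Fin 2 → ℕ) :
    ladderWeight i b p ^ 2 ≤ p 0 + p 1 + 1 := by
  have h : (p i : ℝ) ≤ p 0 + p 1 := by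
    fin_cases i <;> simp
  cases b
  · rw [sq, ladderWeight_false_mul_self]
    linarith
  · rw [sq, ladderWeight_true_mul_self]
    linarith

theorem ladderIndex_sum_le (i : Fin 2) (b : Bool) (p : Fin 2 → ℕ) :
    ladderIndex i b p 0 + ladderIndex i b p 1 ≤ p 0 + p 1 + 1 := by
  fin_cases i <;> cases b <;> simp [ladderIndex] <;> omega

/-- Products of two ladder operators map vectors with sufficiently decaying Hermite coefficients
into `L²`. -/
theorem exists_toDist_eq_ladder_ladder {u w : L2}
    (hw : ∀ p, ⟪hermiteL2 p, w⟫_ℂ = ((p 0 : ℂ) + p 1 + 1) * ⟪hermiteL2 p, u⟫_ℂ)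
    (i j : Fin 2) (b c : Bool) : ∃ y : L2, ladder i b (ladder j c (toDist u)) = toDist y := by
  set W : (Fin 2 → ℕ) → ℝ := fun p => ladderWeight j c p * ladderWeight i b (ladderIndex j c p)
  set y : (Fin 2 → ℕ) → L2 := fun p =>
    (⟪hermiteL2 p, u⟫_ℂ * W p) • hermiteL2 (ladderIndex i b (ladderIndex j c p))
  -- With n = p₀ + p₁, the first step costs at most n + 1 and the second at most n + 2 ≤ 2(n + 1),
  -- whence the factor 2.
  have hWle : ∀ p, W p ^ 2 ≤ 2 * ((p 0 : ℝ) + p 1 + 1) ^ 2 := by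
    intro p
    have h1 := ladderWeight_sq_le j c p
    have h2 := ladderWeight_sq_le i b (ladderIndex j c p)
    have h3 : (ladderIndex j c p 0 : ℝ) + ladderIndex j c p 1 ≤ p 0 + p 1 + 1 := by
      exact_mod_cast ladderIndex_sum_le j c p
    simp only [W]
    have h0 : (0 : ℝ) ≤ p 0 + p 1 := by positivity
    rw [mul_pow]
    calc _ ≤ ((p 0 : ℝ) + p 1 + 1) * (p 0 + p 1 + 1 + 1) := by
          gcongr
          linarith
      _ ≤ _ := by nlinarith
  have hy : Summable y := by
    refine summable_of_pairwise_orthogonal (fun p r hpr => ?_) ?_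
    · simp only [y, inner_smul_left, inner_smul_right]
      by_cases hp : W p = 0
      · simp [hp]
      by_cases hr : W r = 0
      · simp [hr]
      rw [inner_hermiteL2_of_ne, mul_zero, mul_zero]
      intro h
      have h1 := ladderIndex_injective_of_weight (right_ne_zero_of_mul hp)
        (right_ne_zero_of_mul hr) h
      exact hpr (ladderIndex_injective_of_weight (left_ne_zero_of_mul hp)
        (left_ne_zero_of_mul hr) h1)
    · have hs := (orthonormal_hermiteL2.inner_products_summable w).mul_left 2
      refine Summable.of_nonneg_of_le (fun _ => by positivity) (fun p => ?_) hs
      simp only [y]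
      rw [norm_smul, orthonormal_hermiteL2.1, mul_one, norm_mul, mul_pow, hw, norm_mul, mul_pow,
        Complex.norm_real, Real.norm_eq_abs, sq_abs]
      have h1 : ‖(p 0 : ℂ) + p 1 + 1‖ = (p 0 : ℝ) + p 1 + 1 := by
        have : (p 0 : ℂ) + p 1 + 1 = ((p 0 + p 1 + 1 : ℕ) : ℂ) := by push_cast; rfl
        rw [this, Complex.norm_natCast]
        push_cast
        rfl
      rw [h1]
      nlinarith [hWle p, sq_nonneg ‖⟪hermiteL2 p, u⟫_ℂ‖]
  refine ⟨∑' p, y p, apply_toDist_of_hasSum (A := ladder i b ∘ₗ ladder j c)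
    (B := fun f => ladderS j (!c) (ladderS i (!b) f)) (fun U f => ?_) (hasSum_hermiteL2 u)
    hy.hasSum fun p => ?_⟩
  · rw [LinearMap.comp_apply, ladder_apply, ladder_apply]
  · simp only [LinearMap.comp_apply, map_smul, ladder_hermiteL2, y, smul_smul, W]
    push_cast
    rfl

/-- In the symmetrized product the mixed terms x∂ and ∂x cancel, so no commutation relation is
needed. -/
theorem ladder_sq_sub (i : Fin 2) (U : 𝓢'(Plane, ℂ)) :
    mulX i (mulX i U) - partialX i (partialX i U) =
      ladder i false (ladder i true U) + ladder i true (ladder i false U) := by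
  have h2 : ((Real.sqrt 2 : ℝ) : ℂ)⁻¹ * ((Real.sqrt 2 : ℝ) : ℂ)⁻¹ = 1 / 2 := by
    rw [← mul_inv, ← Complex.ofReal_mul, Real.mul_self_sqrt (by norm_num)]
    norm_num
  simp only [ladder, ladderSign, Bool.false_eq_true, if_false, if_true, LinearMap.smul_apply,
    LinearMap.add_apply, map_smul, map_add, one_smul, neg_smul, map_neg, smul_smul, smul_add,
    LinearMap.neg_apply, smul_neg, h2]
  module

theorem mulX_eq_ladder (i : Fin 2) (U : 𝓢'(Plane, ℂ)) :
    mulX i U = ((Real.sqrt 2 : ℝ) : ℂ)⁻¹ • (ladder i false U + ladder i true U) := by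
  have h2 : ((Real.sqrt 2 : ℝ) : ℂ)⁻¹ * ((Real.sqrt 2 : ℝ) : ℂ)⁻¹ = 1 / 2 := by
    rw [← mul_inv, ← Complex.ofReal_mul, Real.mul_self_sqrt (by norm_num)]
    norm_num
  simp only [ladder, ladderSign, Bool.false_eq_true, if_false, if_true, LinearMap.smul_apply,
    LinearMap.add_apply, one_smul, neg_smul, smul_smul, smul_add,
    LinearMap.neg_apply, smul_neg, h2]
  module

theorem partialX_eq_ladder (i : Fin 2) (U : 𝓢'(Plane, ℂ)) :
    partialX i U = ((Real.sqrt 2 : ℝ) : ℂ)⁻¹ • (ladder i false U - ladder i true U) := by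
  have h2 : ((Real.sqrt 2 : ℝ) : ℂ)⁻¹ * ((Real.sqrt 2 : ℝ) : ℂ)⁻¹ = 1 / 2 := by
    rw [← mul_inv, ← Complex.ofReal_mul, Real.mul_self_sqrt (by norm_num)]
    norm_num
  simp only [ladder, ladderSign, Bool.false_eq_true, if_false, if_true, LinearMap.smul_apply,
    LinearMap.add_apply, one_smul, neg_smul, smul_smul, smul_add, smul_sub,
    LinearMap.neg_apply, smul_neg, h2]
  module

theorem laplacian_eq_partialX (U : 𝓢'(Plane, ℂ)) :
    LineDeriv.laplacianCLM ℂ Plane 𝓢'(Plane, ℂ) U =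
      partialX 0 (partialX 0 U) + partialX 1 (partialX 1 U) := by
  rw [TemperedDistribution.laplacianCLM_apply,
    TemperedDistribution.laplacian_eq_sum (EuclideanSpace.basisFun (Fin 2) ℝ), Fin.sum_univ_two]
  simp only [EuclideanSpace.basisFun_apply]
  rfl

theorem ladder_false_true_apply_hermiteS (i : Fin 2) (U : 𝓢'(Plane, ℂ)) (p : Fin 2 → ℕ) :
    ladder i false (ladder i true U) (hermiteS p) = ((p i : ℂ) + 1) * U (hermiteS p) := by
  rw [ladder_apply, ladder_apply, Bool.not_false, Bool.not_true, ladderS_hermiteS, map_smul,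
    map_smul, ladderS_hermiteS, map_smul, ladderIndex_true_false, ladderWeight_true, smul_smul,
    ← Complex.ofReal_mul, ladderWeight_true_mul_self, smul_eq_mul]
  push_cast
  rfl

theorem ladder_true_false_apply_hermiteS (i : Fin 2) (U : 𝓢'(Plane, ℂ)) (p : Fin 2 → ℕ) :
    ladder i true (ladder i false U) (hermiteS p) = (p i : ℂ) * U (hermiteS p) := by
  rw [ladder_apply, ladder_apply, Bool.not_false, Bool.not_true, ladderS_hermiteS, map_smul,
    map_smul, ladderS_hermiteS, map_smul]
  by_cases h : p i = 0
  · simp [h, ladderWeight]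
  · have h1 : ladderWeight i true (ladderIndex i false p) = ladderWeight i false p := by
      rw [← ladderWeight_true, ladderIndex_false_true i p h]
    rw [ladderIndex_false_true i p h, h1, smul_smul,
      ← Complex.ofReal_mul, ladderWeight_false_mul_self, smul_eq_mul]
    push_cast
    rfl

/-- Membership in `D(H₀)` in terms of Hermite coefficients. -/
theorem mem_domainH0_iff {u : L2} : u ∈ domainH0 ↔
    ∃ w : L2, ∀ p, ⟪hermiteL2 p, w⟫_ℂ = ((p 0 : ℂ) + p 1 + 1) * ⟪hermiteL2 p, u⟫_ℂ := by
  constructor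
  · rintro ⟨⟨a, ha⟩, ⟨b, hb⟩⟩
    change toDist a = LineDeriv.laplacianCLM ℂ Plane 𝓢'(Plane, ℂ) (toDist u) at ha
    change toDist b = mulX 0 (mulX 0 (toDist u)) + mulX 1 (mulX 1 (toDist u)) at hb
    rw [laplacian_eq_partialX] at ha
    have h : toDist (b - a) = (ladder 0 false (ladder 0 true (toDist u)) +
        ladder 0 true (ladder 0 false (toDist u))) + (ladder 1 false (ladder 1 true (toDist u)) +
        ladder 1 true (ladder 1 false (toDist u))) := by
      rw [map_sub, ha, hb, ← ladder_sq_sub, ← ladder_sq_sub]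
      abel
    -- The witness is H₀u = (-Δ + x²)u/2, whose Hermite coefficients are found by transposing onto
    -- the Hermite functions.
    refine ⟨(1 / 2 : ℂ) • (b - a), fun p => ?_⟩
    rw [inner_smul_right, inner_hermiteL2, inner_hermiteL2, h]
    change 1 / 2 * ((ladder 0 false (ladder 0 true (toDist u)) (hermiteS p) +
        ladder 0 true (ladder 0 false (toDist u)) (hermiteS p)) +
        (ladder 1 false (ladder 1 true (toDist u)) (hermiteS p) +
        ladder 1 true (ladder 1 false (toDist u)) (hermiteS p))) = _
    simp only [ladder_false_true_apply_hermiteS, ladder_true_false_apply_hermiteS]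
    ring
  · rintro ⟨w, hw⟩
    -- Each second-order product of ladder operators separately sends u into L², hence so do Δ and
    -- x₁² + x₂², which are combinations of them.
    have h := exists_toDist_eq_ladder_ladder hw
    have hr : ∀ i j b c, ladder i b (ladder j c (toDist u)) ∈ LinearMap.range toDist.toLinearMap := by
      intro i j b c
      obtain ⟨y, hy⟩ := h i j b c
      exact ⟨y, hy.symm⟩
    refine ⟨?_, ?_⟩
    · change LineDeriv.laplacianCLM ℂ Plane 𝓢'(Plane, ℂ) (toDist u) ∈
        LinearMap.range toDist.toLinearMap
      rw [laplacian_eq_partialX]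
      simp only [partialX_eq_ladder, map_smul, map_sub]
      refine Submodule.add_mem _ ?_ ?_ <;>
      exact Submodule.smul_mem _ _ (Submodule.sub_mem _
        (Submodule.smul_mem _ _ (Submodule.sub_mem _ (hr _ _ _ _) (hr _ _ _ _)))
        (Submodule.smul_mem _ _ (Submodule.sub_mem _ (hr _ _ _ _) (hr _ _ _ _))))
    · change mulX 0 (mulX 0 (toDist u)) + mulX 1 (mulX 1 (toDist u)) ∈
        LinearMap.range toDist.toLinearMap
      simp only [mulX_eq_ladder, map_smul, map_add]
      refine Submodule.add_mem _ ?_ ?_ <;>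
      exact Submodule.smul_mem _ _ (Submodule.add_mem _
        (Submodule.smul_mem _ _ (Submodule.add_mem _ (hr _ _ _ _) (hr _ _ _ _)))
        (Submodule.smul_mem _ _ (Submodule.add_mem _ (hr _ _ _ _) (hr _ _ _ _))))

end Domain

/-! ### The matrix of the nilpotent part -/

section Matrix

/-- The entries of `D m` on the first superdiagonal. -/
def superdiag (m i : ℕ) : ℝ := Real.sqrt (((i : ℝ) + 1) * ((m : ℝ) - i))

theorem D_pow_apply (m k : ℕ) (i j : Fin (m + 1)) :
    (D m ^ k) i j = if (j : ℕ) = i + k then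
      ∏ l ∈ Finset.range k, ((superdiag m (i + l) : ℝ) : ℂ) else 0 := by
  induction k generalizing j with
  | zero =>
    simp [Matrix.one_apply, Fin.ext_iff, eq_comm]
  | succ k ih =>
    rw [pow_succ, Matrix.mul_apply]
    simp_rw [ih, D]
    split_ifs with h
    · have hl : (i : ℕ) + k < m + 1 := by omega
      rw [Finset.sum_eq_single ⟨i + k, hl⟩]
      · rw [if_pos rfl, if_pos (by simp; omega), Finset.prod_range_succ]
        simp [superdiag]
      · intro l _ hl'
        rw [if_neg, zero_mul]
        intro h'
        exact hl' (Fin.ext h')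
      · simp
    · refine Finset.sum_eq_zero fun l _ => ?_
      by_cases hl : (l : ℕ) = i + k
      · rw [if_neg (c := (j : ℕ) = l + 1) (by omega), mul_zero]
      · rw [if_neg hl, zero_mul]

theorem D_pow_succ_eq_zero (m : ℕ) : D m ^ (m + 1) = 0 := by
  ext i j
  rw [D_pow_apply, if_neg (by omega), Matrix.zero_apply]

theorem superdiag_pos {m i : ℕ} (h : i < m) : 0 < superdiag m i := by
  have : (i : ℝ) < m := by exact_mod_cast h
  exact Real.sqrt_pos.2 (mul_pos (by positivity) (by linarith))

/-- The top right entry of the m-th power is the product of all superdiagonal entries, each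
positive. -/
theorem D_pow_ne_zero (m : ℕ) : D m ^ m ≠ 0 := by
  intro h
  have h1 := congrFun (congrFun h 0) (Fin.last m)
  rw [D_pow_apply, if_pos (by simp), Matrix.zero_apply, Finset.prod_eq_zero_iff] at h1
  obtain ⟨l, hl, h2⟩ := h1
  rw [Complex.ofReal_eq_zero] at h2
  exact (superdiag_pos (m := m) (i := l) (Finset.mem_range.1 hl)).ne' (by simpa using h2)

theorem D_mulVec_last (m : ℕ) (x : Fin (m + 1) → ℂ) : (D m).mulVec x (Fin.last m) = 0 := by
  rw [Matrix.mulVec, dotProduct]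
  refine Finset.sum_eq_zero fun j _ => ?_
  rw [D, if_neg (by simp; omega), zero_mul]

theorem D_mulVec_castSucc (m : ℕ) (x : Fin (m + 1) → ℂ) (i : Fin m) :
    (D m).mulVec x i.castSucc = (superdiag m i : ℝ) * x i.succ := by
  rw [Matrix.mulVec, dotProduct, Finset.sum_eq_single i.succ]
  · simp [D, superdiag]
  · intro j _ hj
    rw [D, if_neg, zero_mul]
    intro h
    exact hj (Fin.ext (by simpa using h))
  · simp

/-- Arithmetic-geometric mean: (m + 1)² - 4(i + 1)(m - i) = (m - 2i - 1)². The constant 1/2 is what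
turns |g| < 2 into a relative bound below 1. -/
theorem superdiag_le (m i : ℕ) : superdiag m i ≤ ((m : ℝ) + 1) / 2 := by
  refine Real.sqrt_le_iff.2 ⟨by positivity, ?_⟩
  nlinarith [sq_nonneg ((m : ℝ) - 2 * i - 1)]

theorem sum_norm_sq_D_mulVec_le (m : ℕ) (x : Fin (m + 1) → ℂ) :
    ∑ i, ‖(D m).mulVec x i‖ ^ 2 ≤ (((m : ℝ) + 1) / 2) ^ 2 * ∑ i, ‖x i‖ ^ 2 := by
  rw [Fin.sum_univ_castSucc, Fin.sum_univ_succ (fun i => ‖x i‖ ^ 2), D_mulVec_last, mul_add,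
    Finset.mul_sum]
  have h : ∀ i : Fin m, ‖(D m).mulVec x i.castSucc‖ ^ 2 ≤
      (((m : ℝ) + 1) / 2) ^ 2 * ‖x i.succ‖ ^ 2 := by
    intro i
    rw [D_mulVec_castSucc, norm_mul, mul_pow, Complex.norm_real,
      Real.norm_of_nonneg (superdiag_pos i.2).le]
    have := superdiag_le m i
    have := (superdiag_pos i.2).le
    gcongr
  have h2 := Finset.sum_le_sum fun i (_ : i ∈ Finset.univ) => h i
  have h3 : 0 ≤ (((m : ℝ) + 1) / 2) ^ 2 * ‖x 0‖ ^ 2 := by positivity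
  simp only [norm_zero, ne_eq, OfNat.ofNat_ne_zero, not_false_eq_true, zero_pow, add_zero]
  linarith

end Matrix

/-! ### The blocks -/

section HermiteBlocks

theorem phi_eq (m : ℕ) (h : Fin (m + 1)) : phi m h = hermiteL2 ![h, m - h] := rfl

theorem hermiteL2_eq_phi (p : Fin 2 → ℕ) :
    hermiteL2 p = phi (p 0 + p 1) ⟨p 0, by omega⟩ := by
  rw [phi_eq]
  congr 1
  ext i
  fin_cases i <;> simp

theorem orthonormal_phi (m : ℕ) : Orthonormal ℂ (phi m) :=
  orthonormal_hermiteL2.comp (fun h : Fin (m + 1) => ![(h : ℕ), m - h]) fun a b hab => by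
    have := congrFun hab 0
    exact Fin.ext (by simpa using this)

theorem inner_phi_of_ne {m n : ℕ} (hmn : m ≠ n) (h : Fin (m + 1)) (k : Fin (n + 1)) :
    ⟪phi m h, phi n k⟫_ℂ = 0 := by
  rw [phi_eq, phi_eq]
  refine inner_hermiteL2_of_ne fun he => ?_
  have h0 := congrFun he 0
  have h1 := congrFun he 1
  simp at h0 h1
  omega

theorem isHilbertSum_Hm : IsHilbertSum ℂ (fun m : ℕ => Hm m) fun m : ℕ => (Hm m).subtypeₗᵢ := by
  refine IsHilbertSum.mkInternal (F := Hm) ?_ ?_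
  · refine OrthogonalFamily.of_pairwise fun m n hmn => ?_
    change Hm m ⟂ Hm n
    rw [Hm, Hm, Submodule.isOrtho_span]
    rintro _ ⟨h, rfl⟩ _ ⟨k, rfl⟩
    exact inner_phi_of_ne hmn h k
  · have h1 := (Submodule.topologicalClosure_eq_top_iff).2 span_hermiteL2_orthogonal
    rw [← h1]
    refine Submodule.topologicalClosure_mono (Submodule.span_le.2 ?_)
    rintro _ ⟨p, rfl⟩
    rw [hermiteL2_eq_phi]
    exact Submodule.mem_iSup_of_mem _ (Submodule.subset_span ⟨_, rfl⟩)

theorem phi_mem_Hm (m : ℕ) (h : Fin (m + 1)) : phi m h ∈ Hm m := Submodule.subset_span ⟨h, rfl⟩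

/-- The orthonormal basis `(φ_{m,0}, …, φ_{m,m})` of `Hm m`. -/
def phiBasis (m : ℕ) : OrthonormalBasis (Fin (m + 1)) ℂ (Hm m) :=
  OrthonormalBasis.mk ((orthonormal_phi m).codRestrict (Hm m) (phi_mem_Hm m)) (by
    rw [← Submodule.map_le_map_iff_of_injective (Hm m).injective_subtype, Submodule.map_span,
      ← Set.range_comp, Submodule.map_top, Submodule.range_subtype]
    exact le_rfl)

theorem coe_phiBasis (m : ℕ) (h : Fin (m + 1)) : (phiBasis m h : L2) = phi m h := by
  simp [phiBasis]

theorem finrank_Hm (m : ℕ) : Module.finrank ℂ (Hm m) = m + 1 := by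
  rw [Module.finrank_eq_card_basis (phiBasis m).toBasis, Fintype.card_fin]

theorem repr_toLin_smul {F ι : Type*} [NormedAddCommGroup F] [InnerProductSpace ℂ F] [Fintype ι]
    [DecidableEq ι] (b : OrthonormalBasis ι ℂ F) (c : ℂ) (M : Matrix ι ι ℂ) (v : F) (i : ι) :
    b.repr (Matrix.toLin b.toBasis b.toBasis (c • M) v) i = c * M.mulVec (b.repr v) i := by
  have h := congrFun (Matrix.repr_toLin b.toBasis b.toBasis (c • M) v) i
  rw [Matrix.smul_mulVec, Pi.smul_apply, smul_eq_mul, OrthonormalBasis.coe_toBasis_repr_apply] at h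
  rw [h]
  congr 2

theorem toLin_smul_one_add {F ι : Type*} [AddCommGroup F] [Module ℂ F] [Fintype ι]
    [DecidableEq ι] (b : Module.Basis ι ℂ F) (c : ℂ) (M : Matrix ι ι ℂ) (v : F) :
    Matrix.toLin b b (c • (1 : Matrix ι ι ℂ) + M) v = c • v + Matrix.toLin b b M v := by
  simp

/-- The nilpotent part `i g a₂^* a₁` of `H(g)` on `Hm m`. -/
def nilPart (g : ℝ) (m : ℕ) : Module.End ℂ (Hm m) :=
  Matrix.toLin (phiBasis m).toBasis (phiBasis m).toBasis ((Complex.I * (g : ℂ)) • D m)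

/-- The restriction of `H(g)` to `Hm m`. -/
def block (g : ℝ) (m : ℕ) : Module.End ℂ (Hm m) :=
  Matrix.toLin (phiBasis m).toBasis (phiBasis m).toBasis
    (((m : ℂ) + 1) • (1 : Matrix (Fin (m + 1)) (Fin (m + 1)) ℂ) + (Complex.I * (g : ℂ)) • D m)

theorem block_apply (g : ℝ) (m : ℕ) (v : Hm m) :
    block g m v = ((m : ℂ) + 1) • v + nilPart g m v := by
  exact toLin_smul_one_add _ _ _ v

theorem isNilpotent_nilPart (g : ℝ) (m : ℕ) : IsNilpotent (nilPart g m) := by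
  refine ⟨m + 1, ?_⟩
  rw [nilPart, ← Matrix.toLin_pow, smul_pow, D_pow_succ_eq_zero, smul_zero, map_zero]

theorem repr_nilPart (g : ℝ) (m : ℕ) (v : Hm m) (i : Fin (m + 1)) :
    (phiBasis m).repr (nilPart g m v) i =
      (Complex.I * (g : ℂ)) * (D m).mulVec ((phiBasis m).repr v) i := by
  exact repr_toLin_smul (phiBasis m) _ _ v i

theorem norm_nilPart_le (g : ℝ) (m : ℕ) (v : Hm m) :
    ‖nilPart g m v‖ ≤ |g| / 2 * (m + 1) * ‖v‖ := by
  refine abs_le_of_sq_le_sq' ?_ (by positivity) |>.2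
  have h : ∀ w : Hm m, ‖w‖ ^ 2 = ∑ i, ‖(phiBasis m).repr w i‖ ^ 2 := by
    intro w
    rw [← (phiBasis m).repr.norm_map, EuclideanSpace.norm_sq_eq]
  rw [mul_pow, h, h]
  simp_rw [repr_nilPart, norm_mul, mul_pow, Complex.norm_I, Complex.norm_real, Real.norm_eq_abs]
  rw [← Finset.mul_sum]
  have := sum_norm_sq_D_mulVec_le m ((phiBasis m).repr v)
  calc _ ≤ 1 ^ 2 * |g| ^ 2 * ((((m : ℝ) + 1) / 2) ^ 2 * ∑ i, ‖(phiBasis m).repr v i‖ ^ 2) := by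
        gcongr
    _ = _ := by ring

theorem mem_span_of_nilPart_eq_zero {g : ℝ} (hg : g ≠ 0) {m : ℕ} {v : Hm m}
    (hv : nilPart g m v = 0) : v ∈ Submodule.span ℂ {phiBasis m 0} := by
  have h : ∀ i : Fin m, (phiBasis m).repr v i.succ = 0 := by
    intro i
    have h1 := repr_nilPart g m v i.castSucc
    rw [hv, D_mulVec_castSucc] at h1
    have h2 : (superdiag m i : ℂ) ≠ 0 := Complex.ofReal_ne_zero.2 (superdiag_pos i.2).ne'
    have h3 : (g : ℂ) ≠ 0 := Complex.ofReal_ne_zero.2 hg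
    simpa [h2, h3] using h1.symm
  rw [← (phiBasis m).sum_repr v, Fin.sum_univ_succ]
  simp_rw [h]
  simp only [zero_smul, Finset.sum_const_zero, add_zero]
  exact Submodule.smul_mem _ _ (Submodule.mem_span_singleton_self _)

theorem nilPart_phiBasis_zero (g : ℝ) (m : ℕ) : nilPart g m (phiBasis m 0) = 0 := by
  refine (phiBasis m).repr.injective ?_
  ext i
  rw [repr_nilPart, map_zero (phiBasis m).repr]
  refine Fin.lastCases ?_ (fun i => ?_) i
  · rw [D_mulVec_last]
    simp
  · rw [D_mulVec_castSucc, (phiBasis m).repr_self]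
    simp

theorem ker_nilPart {g : ℝ} (hg : g ≠ 0) (m : ℕ) :
    LinearMap.ker (nilPart g m) = Submodule.span ℂ {phiBasis m 0} := by
  refine le_antisymm (fun v hv => mem_span_of_nilPart_eq_zero hg hv) ?_
  rw [Submodule.span_singleton_le_iff_mem]
  exact nilPart_phiBasis_zero g m

/-- All eigenvectors lie on one line, while the block has dimension m + 1 ≥ 2. -/
theorem iSup_eigenspace_block_ne_top {g : ℝ} (hg : g ≠ 0) {m : ℕ} (hm : 1 ≤ m) :
    ⨆ μ : ℂ, (block g m).eigenspace μ ≠ ⊤ := by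
  have hle : ⨆ μ : ℂ, (block g m).eigenspace μ ≤ Submodule.span ℂ {phiBasis m 0} := by
    refine iSup_le fun μ v hv => ?_
    rw [Module.End.mem_eigenspace_iff, block_apply] at hv
    by_cases hμ : (m : ℂ) + 1 - μ = 0
    · rw [sub_eq_zero.1 hμ] at hv
      exact mem_span_of_nilPart_eq_zero hg (by simpa using hv)
    · have : v = 0 := sub_smul_eq_zero_of_nilpotent (isNilpotent_nilPart g m) hμ (by
        rw [sub_smul, sub_add_eq_add_sub, hv, sub_self])
      rw [this]
      exact Submodule.zero_mem _
  intro h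
  rw [h, top_le_iff] at hle
  have h0 : phiBasis m 0 ≠ 0 := (phiBasis m).orthonormal.ne_zero 0
  have h1 := finrank_span_singleton (K := ℂ) h0
  rw [hle, finrank_top, finrank_Hm] at h1
  omega

end HermiteBlocks

/-! ### The operator as a direct sum of its blocks -/

section DirectSum

theorem proj_span_eq_smul_iff {E ι : Type*} [NormedAddCommGroup E] [InnerProductSpace ℂ E]
    (e : ι → E) [(Submodule.span ℂ (Set.range e)).HasOrthogonalProjection] (c : ℂ) (u w : E) :
    (Submodule.span ℂ (Set.range e)).orthogonalProjectionOnto w =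
        c • (Submodule.span ℂ (Set.range e)).orthogonalProjectionOnto u ↔
      ∀ i, ⟪e i, w⟫_ℂ = c * ⟪e i, u⟫_ℂ := by
  rw [← map_smul, ← sub_eq_zero, ← map_sub, Submodule.orthogonalProjectionOnto_eq_zero_iff]
  simp_rw [← inner_smul_right, ← sub_eq_zero (b := ⟪e _, c • u⟫_ℂ), ← inner_sub_right]
  refine ⟨fun h i => h _ (Submodule.subset_span ⟨i, rfl⟩), fun h x hx => ?_⟩
  induction hx using Submodule.span_induction with
  | mem x hx =>
    obtain ⟨i, rfl⟩ := hx
    exact h i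
  | zero => exact inner_zero_left _
  | add x y _ _ hx hy => rw [inner_add_left, hx, hy, add_zero]
  | smul a x _ hx => rw [inner_smul_left, hx, mul_zero]

/-- Riesz–Fischer: prescribed components come from a vector exactly when their norms are square
summable. -/
theorem exists_proj_eq_smul_iff {E : Type*} [NormedAddCommGroup E] [InnerProductSpace ℂ E]
    [CompleteSpace E] {V : ℕ → Submodule ℂ E} [∀ m, FiniteDimensional ℂ (V m)]
    (hV : IsHilbertSum ℂ (fun m => V m) fun m => (V m).subtypeₗᵢ) {c : ℕ → ℂ} {u : E} :
    (∃ w, ∀ m, (V m).orthogonalProjectionOnto w = c m • (V m).orthogonalProjectionOnto u) ↔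
      Summable fun m => (‖c m‖ * ‖(V m).orthogonalProjectionOnto u‖) ^ 2 := by
  simp_rw [← norm_smul]
  constructor
  · rintro ⟨w, hw⟩
    simp_rw [← hw]
    exact summable_norm_sq_proj hV w
  · intro h
    exact ⟨_, fun m => proj_of_hasSum hV (summable_coe_of_norm_sq hV h).hasSum m⟩

theorem formalH_eq_ladder (g : ℝ) (U : 𝓢'(Plane, ℂ)) :
    formalH g U = ladder 0 true (ladder 0 false U) + ladder 1 true (ladder 1 false U) +
      (Complex.I * (g : ℂ)) • ladder 1 true (ladder 0 false U) + U := by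
  simp only [ladder_true, ladder_false]
  rfl

/-- The number terms are their own transposes, while a₂^* a₁ becomes a₁^* a₂. Having a transpose
lets the formal operator pass through L²-convergent sums. -/
theorem formalH_apply (g : ℝ) (U : 𝓢'(Plane, ℂ)) (f : 𝓢(Plane, ℂ)) :
    formalH g U f = U (ladderS 0 true (ladderS 0 false f) + ladderS 1 true (ladderS 1 false f) +
      (Complex.I * (g : ℂ)) • ladderS 0 true (ladderS 1 false f) + f) := by
  rw [formalH_eq_ladder, map_add, map_add, map_add, map_smul]
  have h : ∀ i j, ladder i true (ladder j false U) f = U (ladderS j true (ladderS i false f)) := by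
    intro i j
    rw [ladder_apply, ladder_apply, Bool.not_true, Bool.not_false]
  rw [← h, ← h, ← h]
  rfl

theorem ladder_true_false_hermiteL2 (i : Fin 2) (p : Fin 2 → ℕ) :
    ladder i true (ladder i false (toDist (hermiteL2 p))) = (p i : ℂ) • toDist (hermiteL2 p) := by
  rw [ladder_hermiteL2, map_smul, ladder_hermiteL2, smul_smul]
  by_cases h : p i = 0
  · rw [← map_smul, ← map_smul]
    congr 1
    simp [h, ladderWeight]
  · rw [ladderIndex_false_true i p h, ← ladderWeight_true, ladderIndex_false_true i p h,
      ← Complex.ofReal_mul, ladderWeight_false_mul_self, Complex.ofReal_natCast]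

theorem ladder_exchange_phi_zero (m : ℕ) :
    ladder 1 true (ladder 0 false (toDist (phi m 0))) = toDist 0 := by
  have h : ladderWeight 0 false ![((0 : Fin (m + 1)) : ℕ), m - (0 : Fin (m + 1))] = 0 := by
    simp [ladderWeight]
  rw [phi_eq, ladder_hermiteL2, h, ← map_smul, Complex.ofReal_zero, zero_smul, map_zero toDist, map_zero]

/-- Lowering h + 1 in the first variable gives √(h + 1); raising m - h - 1 in the second gives √(m -
h). -/
theorem ladder_exchange_phi_succ (m : ℕ) (h : Fin m) :
    ladder 1 true (ladder 0 false (toDist (phi m h.succ))) =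
      ((superdiag m h : ℝ) : ℂ) • toDist (phi m h.castSucc) := by
  rw [phi_eq, phi_eq, ladder_hermiteL2, map_smul, ladder_hermiteL2, smul_smul, ← Complex.ofReal_mul]
  have hm : (h : ℕ) + 1 ≤ m := h.2
  congr 2
  · rw [superdiag, Real.sqrt_mul (by positivity)]
    have e : (m : ℝ) - (h + 1) + 1 = m - h := by ring
    simp [ladderWeight, ladderIndex, Nat.cast_sub hm, e]
  · refine congrArg hermiteL2 (funext fun i => ?_)
    fin_cases i
    · simp [ladderIndex]
    · simp [ladderIndex]
      omega

theorem nilPart_phiBasis_succ (g : ℝ) (m : ℕ) (h : Fin m) :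
    nilPart g m (phiBasis m h.succ) =
      (Complex.I * (g : ℂ) * (superdiag m h : ℝ)) • phiBasis m h.castSucc := by
  refine (phiBasis m).repr.injective ?_
  ext i
  rw [repr_nilPart, map_smul (phiBasis m).repr, (phiBasis m).repr_self, (phiBasis m).repr_self]
  refine Fin.lastCases ?_ (fun i => ?_) i
  · rw [D_mulVec_last]
    simp [Fin.ext_iff, h.2.ne]
  · rw [D_mulVec_castSucc]
    by_cases hi : i = h
    · subst hi
      simp
    · simp [hi]

theorem coe_nilPart_phiBasis_succ (g : ℝ) (m : ℕ) (h : Fin m) :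
    (nilPart g m (phiBasis m h.succ) : L2) =
      (Complex.I * (g : ℂ) * (superdiag m h : ℝ)) • phi m h.castSucc := by
  rw [← coe_phiBasis m h.castSucc]
  exact congrArg (Hm m).subtype (nilPart_phiBasis_succ g m h)

theorem coe_block (g : ℝ) (m : ℕ) (v : Hm m) :
    (block g m v : L2) = ((m : ℂ) + 1) • (v : L2) + (nilPart g m v : L2) :=
  congrArg (Hm m).subtype (block_apply g m v)

theorem exchange_toDist_phi (g : ℝ) (m : ℕ) (h : Fin (m + 1)) :
    (Complex.I * (g : ℂ)) • ladder 1 true (ladder 0 false (toDist (phi m h))) =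
      toDist (nilPart g m (phiBasis m h) : L2) := by
  obtain rfl | ⟨k, rfl⟩ := Fin.eq_zero_or_eq_succ h
  · have h0 : (nilPart g m (phiBasis m 0) : L2) = 0 :=
      congrArg (Hm m).subtype (nilPart_phiBasis_zero g m)
    rw [ladder_exchange_phi_zero, h0, ← map_smul, smul_zero]
  · rw [ladder_exchange_phi_succ, coe_nilPart_phiBasis_succ, ← map_smul, ← map_smul, smul_smul]

theorem number_toDist_phi (m : ℕ) (h : Fin (m + 1)) :
    ladder 0 true (ladder 0 false (toDist (phi m h))) +
      ladder 1 true (ladder 1 false (toDist (phi m h))) = toDist ((m : ℂ) • phi m h) := by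
  rw [phi_eq, ladder_true_false_hermiteL2, ladder_true_false_hermiteL2, ← map_smul, ← map_smul,
    ← map_add, ← add_smul]
  congr 2
  have : (h : ℕ) ≤ m := Nat.lt_succ_iff.1 h.2
  simp [Nat.cast_sub this]

theorem formalH_toDist_phi (g : ℝ) (m : ℕ) (h : Fin (m + 1)) :
    formalH g (toDist (phi m h)) = toDist (block g m (phiBasis m h) : L2) := by
  rw [coe_block, coe_phiBasis, formalH_eq_ladder, number_toDist_phi, exchange_toDist_phi,
    ← map_add, ← map_add]
  congr 1
  rw [add_smul, one_smul]
  abel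

theorem formalH_toDist_Hm (g : ℝ) (m : ℕ) (v : Hm m) :
    formalH g (toDist v) = toDist (block g m v : L2) := by
  have key : formalH g ∘ₗ toDist.toLinearMap ∘ₗ (Hm m).subtype =
      toDist.toLinearMap ∘ₗ (Hm m).subtype ∘ₗ block g m := by
    refine (phiBasis m).toBasis.ext fun h => ?_
    rw [OrthonormalBasis.coe_toBasis]
    change formalH g (toDist (phiBasis m h : L2)) = toDist (block g m (phiBasis m h) : L2)
    rw [coe_phiBasis]
    exact formalH_toDist_phi g m h
  exact LinearMap.congr_fun key v

/-- Holds for every real g; hence the graph definition of `H g` loses no vector of D(H₀). -/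
theorem exists_formalH_eq {g : ℝ} {u : L2} (hu : u ∈ domainH0) :
    ∃ w, formalH g (toDist u) = toDist w := by
  obtain ⟨w, hw⟩ := mem_domainH0_iff.1 hu
  obtain ⟨a, ha⟩ := exists_toDist_eq_ladder_ladder hw 0 0 true false
  obtain ⟨b, hb⟩ := exists_toDist_eq_ladder_ladder hw 1 1 true false
  obtain ⟨c, hc⟩ := exists_toDist_eq_ladder_ladder hw 1 0 true false
  refine ⟨a + b + (Complex.I * (g : ℂ)) • c + u, ?_⟩
  rw [formalH_eq_ladder, ha, hb, hc, map_add, map_add, map_add, map_smul]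

theorem domain_H (g : ℝ) : (H g).domain = domainH0 := by
  ext u
  rw [LinearPMap.mem_domain_iff, graph_H]
  constructor
  · rintro ⟨w, hw⟩
    exact hw.1
  · intro hu
    obtain ⟨w, hw⟩ := exists_formalH_eq (g := g) hu
    refine ⟨w, hu, ?_⟩
    change toDist w - formalH g (toDist u) = 0
    rw [hw, sub_self]

theorem toDist_H (g : ℝ) (u : (H g).domain) :
    toDist (H g u) = formalH g (toDist (u : L2)) := by
  have h := (H g).mem_graph u
  rw [graph_H] at h
  have h2 : toDist (H g u) - formalH g (toDist (u : L2)) = 0 := h.2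
  exact sub_eq_zero.1 h2

theorem mem_domainH0_iff_proj {u : L2} : u ∈ domainH0 ↔ ∃ w : L2, ∀ m : ℕ,
    (Hm m).orthogonalProjectionOnto w = ((m : ℂ) + 1) • (Hm m).orthogonalProjectionOnto u := by
  rw [mem_domainH0_iff]
  refine exists_congr fun w => ?_
  have h : ∀ m : ℕ, (Hm m).orthogonalProjectionOnto w =
      ((m : ℂ) + 1) • (Hm m).orthogonalProjectionOnto u ↔
      ∀ h, ⟪phi m h, w⟫_ℂ = ((m : ℂ) + 1) * ⟪phi m h, u⟫_ℂ :=
    fun m => by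
      have : (Submodule.span ℂ (Set.range (phi m))).HasOrthogonalProjection :=
        inferInstanceAs (Hm m).HasOrthogonalProjection
      exact proj_span_eq_smul_iff (phi m) _ u w
  simp_rw [h]
  constructor
  · intro hw m h
    rw [phi_eq, hw]
    have : (h : ℕ) ≤ m := Nat.lt_succ_iff.1 h.2
    simp [Nat.cast_sub this]
  · intro hw p
    rw [hermiteL2_eq_phi, hw]
    push_cast
    rfl

theorem mem_domainH0_iff_summable {u : L2} : u ∈ domainH0 ↔
    Summable fun m : ℕ => (((m : ℝ) + 1) * ‖(Hm m).orthogonalProjectionOnto u‖) ^ 2 := by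
  rw [mem_domainH0_iff_proj, exists_proj_eq_smul_iff isHilbertSum_Hm]
  refine summable_congr fun m => ?_
  rw [← Nat.cast_add_one, Complex.norm_natCast, Nat.cast_add_one]

theorem norm_block_le (g : ℝ) (m : ℕ) (v : Hm m) :
    ‖block g m v‖ ≤ (1 + |g| / 2) * ((m + 1) * ‖v‖) := by
  rw [block_apply]
  refine (norm_add_le _ _).trans ?_
  rw [norm_smul, ← Nat.cast_add_one, Complex.norm_natCast]
  have := norm_nilPart_le g m v
  push_cast
  linarith

theorem le_norm_block (g : ℝ) (m : ℕ) (v : Hm m) :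
    (1 - |g| / 2) * ((m + 1) * ‖v‖) ≤ ‖block g m v‖ := by
  have h1 : ‖((m : ℂ) + 1) • v‖ ≤ ‖block g m v‖ + ‖nilPart g m v‖ := by
    have := norm_sub_le (block g m v) (nilPart g m v)
    rwa [block_apply, add_sub_cancel_right, ← block_apply] at this
  rw [norm_smul, ← Nat.cast_add_one, Complex.norm_natCast] at h1
  have := norm_nilPart_le g m v
  push_cast at h1
  linarith

/-- The block norms lie between (1 - |g|/2)(m + 1) and (1 + |g|/2)(m + 1) times ‖v‖; |g| < 2 makes
the lower constant positive. -/
theorem mem_domain_H_iff {g : ℝ} (hg : |g| < 2) (u : L2) : u ∈ (H g).domain ↔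
    Summable fun m => ‖block g m ((Hm m).orthogonalProjectionOnto u)‖ ^ 2 := by
  rw [domain_H, mem_domainH0_iff_summable]
  constructor
  · intro h
    refine Summable.of_nonneg_of_le (fun _ => by positivity) (fun m => ?_)
      (h.mul_left ((1 + |g| / 2) ^ 2))
    rw [← mul_pow]
    exact pow_le_pow_left₀ (norm_nonneg _) (norm_block_le g m _) 2
  · intro h
    have hq : 0 < 1 - |g| / 2 := by linarith
    refine Summable.of_nonneg_of_le (fun _ => by positivity) (fun m => ?_)
      (h.mul_left (((1 - |g| / 2) ^ 2)⁻¹))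
    rw [inv_mul_eq_div, le_div_iff₀' (by positivity), ← mul_pow]
    exact pow_le_pow_left₀ (by positivity) (le_norm_block g m _) 2

/-- The formal operator is applied term by term to u = ∑ P_m u, and injectivity of the embedding
into distributions identifies the sum with `H g u`. -/
theorem isBlockSum_H {g : ℝ} (hg : |g| < 2) : IsBlockSum (H g) (block g) := by
  refine ⟨mem_domain_H_iff hg, fun u => ?_⟩
  have h := (summable_coe_of_norm_sq isHilbertSum_Hm ((mem_domain_H_iff hg u).1 u.2)).hasSum
  have h2 := apply_toDist_of_hasSum (formalH_apply g) (hasSum_proj isHilbertSum_Hm (u : L2)) h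
    fun m => formalH_toDist_Hm g m _
  rw [← toDist_H] at h2
  rwa [toDist_injective h2]

theorem eigenspace_H {g : ℝ} (hg : |g| < 2) (hg0 : g ≠ 0) (m : ℕ) :
    eigenspace (H g) ((m : ℂ) + 1) = Submodule.span ℂ {phi m 0} := by
  rw [(isBlockSum_H hg).eigenspace_eq isHilbertSum_Hm (block_apply g) (isNilpotent_nilPart g),
    ker_nilPart hg0, Submodule.map_span, Set.image_singleton, Submodule.subtype_apply, coe_phiBasis]

theorem nontrivial_Hm (m : ℕ) : Nontrivial (Hm m) :=
  Module.nontrivial_of_finrank_pos (R := ℂ) (by rw [finrank_Hm]; omega)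

theorem spec_H {g : ℝ} (hg : |g| < 2) : spec (H g) = Set.range fun m : ℕ => (m : ℂ) + 1 :=
  (isBlockSum_H hg).spec_eq isHilbertSum_Hm (block_apply g) (isNilpotent_nilPart g) nontrivial_Hm
    (by linarith) (norm_nilPart_le g)

theorem setOf_isEigenvalue_H {g : ℝ} (hg : |g| < 2) :
    {μ : ℂ | IsEigenvalue (H g) μ} = Set.range fun m : ℕ => (m : ℂ) + 1 :=
  (isBlockSum_H hg).setOf_isEigenvalue isHilbertSum_Hm (block_apply g) (isNilpotent_nilPart g)
    nontrivial_Hm (by linarith) (norm_nilPart_le g)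

theorem hasAlgebraicMultiplicity_H {g : ℝ} (hg : |g| < 2) (m : ℕ) :
    HasAlgebraicMultiplicity (H g) ((m : ℂ) + 1) (m + 1) := by
  have := (isBlockSum_H hg).hasAlgebraicMultiplicity isHilbertSum_Hm (block_apply g)
    (isNilpotent_nilPart g) (spec_H hg) m
  rwa [finrank_Hm] at this

/-- Every eigenvector is a multiple of some φ_{m,0}, so φ_{1,1} is orthogonal to their closed span.
-/
theorem not_isDiagonalizable_H {g : ℝ} (hg : |g| < 2) (hg0 : g ≠ 0) : ¬ IsDiagonalizable (H g) := by
  intro h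
  have hle : ⨆ μ : ℂ, eigenspace (H g) μ ≤ (Submodule.span ℂ {phi 1 1})ᗮ := by
    refine iSup_le fun μ => ?_
    by_cases hμ : IsEigenvalue (H g) μ
    · have : μ ∈ {μ : ℂ | IsEigenvalue (H g) μ} := hμ
      rw [setOf_isEigenvalue_H hg] at this
      obtain ⟨m, rfl⟩ := this
      change eigenspace (H g) ((m : ℂ) + 1) ≤ _
      rw [eigenspace_H hg hg0, Submodule.span_singleton_le_iff_mem,
        Submodule.mem_orthogonal_singleton_iff_inner_right]
      by_cases hm : 1 = m
      · subst hm
        exact (orthonormal_phi 1).2 (by decide)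
      · exact inner_phi_of_ne hm _ _
    · rw [not_not.1 hμ]
      exact bot_le
  have h2 := Submodule.topologicalClosure_minimal _ hle (Submodule.isClosed_orthogonal _)
  rw [h, top_le_iff, Submodule.orthogonal_eq_top_iff, Submodule.span_singleton_eq_bot] at h2
  exact (orthonormal_phi 1).ne_zero 1 h2

end DirectSum

end PTOscillator

end

open PTOscillator
theorem mainTheorem1 (g : ℝ) (hg : |g| < 2) :
    -- the operator is defined on all of `D(H₀)`
    (H g).domain = domainH0 ∧
    -- spectrum and multiplicities
    HasDiscreteSpectrum (H g) ∧
    spec (H g) = Set.range (fun m : ℕ => (m : ℂ) + 1) ∧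
    {μ : ℂ | IsEigenvalue (H g) μ} = Set.range (fun m : ℕ => (m : ℂ) + 1) ∧
    (g ≠ 0 → ∀ m : ℕ, HasGeometricMultiplicity (H g) ((m : ℂ) + 1) 1) ∧
    (∀ m : ℕ, HasAlgebraicMultiplicity (H g) ((m : ℂ) + 1) (m + 1) ∧
      Module.rank ℂ (rootSpace (H g) ((m : ℂ) + 1)) = ((m + 1 : ℕ) : Cardinal)) ∧
    -- orthogonal decomposition of the space
    (∀ m : ℕ, Module.finrank ℂ (Hm m) = m + 1) ∧
    IsHilbertSum ℂ (fun m : ℕ => Hm m) (fun m : ℕ => (Hm m).subtypeₗᵢ) ∧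
    -- decomposition of the operator, with `S m` the restriction of `H g` to `Hm m`
    (∃ (b : ∀ m : ℕ, OrthonormalBasis (Fin (m + 1)) ℂ (Hm m)) (S : ∀ m : ℕ, Module.End ℂ (Hm m)),
      (∀ m h, (b m h : L2) = phi m h) ∧
      (∀ m (u : Hm m), ∃ hu : (u : L2) ∈ (H g).domain, H g ⟨u, hu⟩ = S m u) ∧
      IsDirectSum (H g) S ∧
      (∀ m : ℕ, LinearMap.toMatrix (b m).toBasis (b m).toBasis (S m) =
        ((m : ℂ) + 1) • (1 : Matrix (Fin (m + 1)) (Fin (m + 1)) ℂ) +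
          (Complex.I * (g : ℂ)) • D m) ∧
      (g ≠ 0 → ∀ m : ℕ, 1 ≤ m → ⨆ μ : ℂ, (S m).eigenspace μ ≠ ⊤)) ∧
    -- nilpotency of order exactly `m + 1`
    (∀ m : ℕ, D m ^ (m + 1) = 0 ∧ D m ^ m ≠ 0) ∧
    -- failure of diagonalizability
    (g ≠ 0 → ¬ IsDiagonalizable (H g)) := by
  -- For the family `Hm`, `IsBlockSum` unfolds to `IsDirectSum`, so `hT` serves as both.
  have hT := isBlockSum_H hg
  refine ⟨domain_H g, ?_, spec_H hg, setOf_isEigenvalue_H hg, fun hg0 m => ?_,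
    fun m => ⟨hasAlgebraicMultiplicity_H hg m, ?_⟩, finrank_Hm, isHilbertSum_Hm,
    ⟨phiBasis, block g, coe_phiBasis, fun m u => ⟨hT.coe_mem_domain isHilbertSum_Hm u,
      hT.apply_coe isHilbertSum_Hm u _⟩, hT, fun m => LinearMap.toMatrix_toLin _ _ _,
      fun hg0 m hm => iSup_eigenspace_block_ne_top hg0 hm⟩,
    fun m => ⟨D_pow_succ_eq_zero m, D_pow_ne_zero m⟩, not_isDiagonalizable_H hg⟩
  · intro μ hμ
    rw [spec_H hg] at hμ
    obtain ⟨m, rfl⟩ := hμ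
    exact ⟨m + 1, hasAlgebraicMultiplicity_H hg m⟩
  · rw [HasGeometricMultiplicity, eigenspace_H hg hg0, ← Module.finrank_eq_rank,
      finrank_span_singleton ((orthonormal_phi m).ne_zero 0)]
  · rw [hT.rootSpace_eq isHilbertSum_Hm (block_apply g) (isNilpotent_nilPart g),
      ← Module.finrank_eq_rank, finrank_Hm]
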